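/- Let $n \ge 1$ be an integer and let $2 < p \le \infty$. For $x \in \mathbb{R}^n$ put $\|x\|_p = \big(\sum_{j=1}^n |x_j|^p\big)^{1/p}$ if $p<\infty$ and $\|x\|_\infty = \max_{j \le n} |x_j|$, and let $B_p^n = \{x \in \mathbb{R}^n : \|x\|_p \le 1\}$. For a unit vector $u \in \mathbb{R}^n$ (in the Euclidean norm), let $\mathrm{Proj}_{u^\perp}$ denote the orthogonal projection of $\mathbb{R}^n$ onto the hyperplane $u^\perp = \{x : \langle x, u\rangle = 0\}$, and let $\mathrm{vol}_{n-1}$ denote $(n-1)$-dimensional volume in $\mathbb{R}^n$, that is, $(n-1)$-dimensional Hausdorff measure normalised so that $(n-1)$-dimensional cubes of side length $1$ have volume $1$. For vectors $x, y \in \mathbb{R}^n$ with nonincreasing rearrangements $x^\downarrow, y^\downarrow$, say that $y$ majorises $x$ if $\sum_{i=1}^k x_i^\downarrow \le \sum_{i=1}^k y_i^\downarrow$ for all $1 \le k \le n$, with equality for $k = n$. Then for every two unit vectors $a$ and $b$ in $\mathbb{R}^n$ such that $(b_1^2, \dots, b_n^2)$ majorises $(a_1^2, \dots, a_n^2)$,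 we have $$\mathrm{vol}_{n-1}\big(\mathrm{Proj}_{a^\perp}(B_p^n)\big) \ \ge\ \mathrm{vol}_{n-1}\big(\mathrm{Proj}_{b^\perp}(B_p^n)\big).$$ -/

import Mathlib

open MeasureTheory
open scoped ENNReal

/-- The nonincreasing rearrangement `x↓` of a vector `x`. (`Tuple.sort x` is a permutation such that
`x ∘ Tuple.sort x` is nondecreasing.) -/
noncomputable def decreasingRearrangement {n : ℕ} (x : Fin n → ℝ) : Fin n → ℝ :=
  fun i => x (Tuple.sort x i.rev)

/-- `Majorizes y x`: the vector `y` majorises the vector `x`, i.e. the sum of the `k` largest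
entries of `x` is at most the sum of the `k` largest entries of `y` for every `k ≤ n`, and the sums
of all the entries are equal. -/
def Majorizes {n : ℕ} (y x : Fin n → ℝ) : Prop :=
  (∀ k : ℕ, k ≤ n →
    ∑ i : Fin n with i.val < k, decreasingRearrangement x i ≤
      ∑ i : Fin n with i.val < k, decreasingRearrangement y i) ∧
  ∑ i, x i = ∑ i, y i

/-- The closed unit ball `B_p^n` of the `ℓ_p` norm (the max norm for `p = ∞`), as a subset of the
Euclidean space `ℝⁿ`. -/
def lpBall (p : ℝ≥0∞) (n : ℕ) : Set (EuclideanSpace ℝ (Fin n)) :=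
  {x | ‖WithLp.toLp p (fun j => x j)‖ ≤ 1}

/-- The orthogonal projection of a set `K` onto the hyperplane `a^⊥`, as a subset of `ℝⁿ`. -/
def hyperplaneProjection {n : ℕ} (a : EuclideanSpace ℝ (Fin n))
    (K : Set (EuclideanSpace ℝ (Fin n))) : Set (EuclideanSpace ℝ (Fin n)) :=
  (ℝ ∙ a)ᗮ.starProjection '' K

/-- `k`-dimensional volume in `ℝⁿ`: the `k`-dimensional Hausdorff measure of the Euclidean metric,
normalised so that `k`-dimensional cubes of side length `1` have volume `1`. -/
noncomputable def vol {n : ℕ} (k : ℕ) (A : Set (EuclideanSpace ℝ (Fin n))) : ℝ≥0∞ :=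
  μHE[k] A

/-! For finite `p`, the volume is rewritten as an integral in which `a` enters linearly. Along a
line `y + s a`, the function `φ(s) = ∑ |y_j + s a_j|^p` is convex and coercive, so `∫ |φ'| e^{-φ} =
2 e^{-min φ}`. The minimum is homogeneous of degree `p` in `y`, and its sublevel set at height 1 in
`a^⊥` is the projection of the ball. Integrating over `a^⊥` therefore shows that the volume is a
constant, independent of `a`, times `∫ |∑ a_j sign(x_j)|x_j|^{p-1}| e^{-∑|x_j|^p} dx`
(`ofReal_mul_powerAbs`).

Substituting `y_j = sign(x_j)|x_j|^{p-1}` turns this into `∫ |∑ a_j y_j| ∏ F(y_j) dy` with `F(y)`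
proportional to `|y|^{q-2} e^{-|y|^q}`, where `q = p/(p-1)` lies in `(1, 2)`
(`powerAbs_eq_weightedAbs`). Both factors of `F` are Gaussian mixtures or limits of them: the power
by the Gamma integral, the exponential as the Laplace transform of a stable law at `y²`. For
Gaussian weights `e^{-s_j y_j²}` the integral is a multiple of `√(∑ a_j²/s_j)`, which is concave in
the `a_j²`; mixtures and limits keep this (`squareConcave_weightedAbs`).

A permutation-invariant function concave in the squares is Schur concave in them, by Rado's theorem
(`mem_convexHull_of_majorizes`, `SquareConcave.le_of_majorizes`). The case `p = ∞` follows by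
squeezing the cube between dilates of finite-`p` balls. -/

/-! ### Majorisation and Rado's theorem. -/

/-- Abel summation: a nonincreasing weight paired with a vector with nonnegative partial sums. -/
lemma mul_sum_le_sum_mul_of_antitone : ∀ {n : ℕ} (w d : Fin n → ℝ) (c : ℝ), Antitone w →
    (∀ i, c ≤ w i) → (∀ k : ℕ, k ≤ n → 0 ≤ ∑ i : Fin n with i.val < k, d i) →
    c * ∑ i, d i ≤ ∑ i, w i * d i
  | 0, _, _, _, _, _, _ => by simp
  | n + 1, w, d, c, hw, hc, hd => by
    have h1 := mul_sum_le_sum_mul_of_antitone (fun i : Fin n => w i.castSucc)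
      (fun i : Fin n => d i.castSucc) (w (Fin.last n))
      (fun i j hij => hw (by simpa using hij)) (fun i => hw (Fin.le_last _)) (by
        intro k hk
        have := hd k (by omega)
        rw [Finset.sum_filter] at this ⊢
        rw [Fin.sum_univ_castSucc] at this
        simpa [hk.not_gt] using this)
    have h2 := hd (n + 1) le_rfl
    rw [Finset.filter_true_of_mem (by intro i _; exact i.2)] at h2
    rw [Fin.sum_univ_castSucc (fun i => w i * d i)]
    have h3 := mul_le_mul_of_nonneg_right (hc (Fin.last n)) h2
    rw [Fin.sum_univ_castSucc d] at h3 ⊢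
    nlinarith

/-- The permutation realising the nonincreasing rearrangement. -/
noncomputable def decreasingSort {n : ℕ} (x : Fin n → ℝ) : Equiv.Perm (Fin n) := Fin.revPerm.trans (Tuple.sort x)

lemma decreasingRearrangement_eq {n : ℕ} (x : Fin n → ℝ) :
    decreasingRearrangement x = x ∘ decreasingSort x := by
  ext i; simp [decreasingRearrangement, decreasingSort]

lemma decreasingRearrangement_antitone {n : ℕ} (x : Fin n → ℝ) :
    Antitone (decreasingRearrangement x) := fun _ _ hij =>
  Tuple.monotone_sort x (Fin.rev_le_rev.2 hij)

/-- The rearrangement inequality bounds the left side by pairing both vectors in sorted order. Abel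
summation then replaces sorted `x` by sorted `y`, the boundary term vanishing because the totals
agree. This is the support-function form of Rado's theorem. -/
lemma sum_mul_le_sum_mul_of_majorizes {n : ℕ} {x y : Fin n → ℝ} (h : Majorizes y x)
    (w : Fin n → ℝ) : ∃ σ : Equiv.Perm (Fin n), ∑ i, x i * w i ≤ ∑ i, y (σ i) * w i := by
  set τ := decreasingSort w
  set W := decreasingRearrangement w
  have hW : W = w ∘ τ := decreasingRearrangement_eq w
  refine ⟨τ.symm.trans (decreasingSort y), ?_⟩
  have e1 : ∑ i, y ((τ.symm.trans (decreasingSort y)) i) * w i =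
      ∑ i, decreasingRearrangement y i * W i := by
    rw [← Equiv.sum_comp τ]
    simp [hW, decreasingRearrangement_eq y]
  have e2 : ∑ i, x i * w i ≤ ∑ i, decreasingRearrangement x i * W i := by
    have hm : Monovary (decreasingRearrangement x) W :=
      (decreasingRearrangement_antitone x).monovary (decreasingRearrangement_antitone w)
    have := hm.sum_comp_perm_mul_le_sum_mul (σ := τ.trans (decreasingSort x).symm)
    rw [← Equiv.sum_comp τ]
    simpa [decreasingRearrangement_eq x, hW] using this
  rw [e1]
  refine e2.trans ?_
  rcases n with _ | n
  · simp
  have h3 := mul_sum_le_sum_mul_of_antitone W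
    (fun i => decreasingRearrangement y i - decreasingRearrangement x i) (W (Fin.last n))
    (decreasingRearrangement_antitone w)
    (fun i => decreasingRearrangement_antitone w (Fin.le_last i))
    (fun k hk => by rw [Finset.sum_sub_distrib]; linarith [h.1 k hk])
  have h4 : ∑ i, (decreasingRearrangement y i - decreasingRearrangement x i) = 0 := by
    rw [Finset.sum_sub_distrib, decreasingRearrangement_eq, decreasingRearrangement_eq]
    simp only [Function.comp_apply, Equiv.sum_comp]
    linarith [h.2]
  rw [h4, mul_zero] at h3
  have : ∑ i, W i * (decreasingRearrangement y i - decreasingRearrangement x i) =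
    ∑ i, decreasingRearrangement y i * W i - ∑ i, decreasingRearrangement x i * W i := by
    rw [← Finset.sum_sub_distrib]
    exact Finset.sum_congr rfl fun i _ => by ring
  linarith

/-- Rado's theorem: a vector is a convex combination of the permutations of any vector that
majorises it. -/
theorem mem_convexHull_of_majorizes {n : ℕ} {x y : Fin n → ℝ} (h : Majorizes y x) :
    x ∈ convexHull ℝ (Set.range fun σ : Equiv.Perm (Fin n) => fun i => y (σ i)) := by
  by_contra hx
  have hfin : (Set.range fun σ : Equiv.Perm (Fin n) => fun i => y (σ i)).Finite :=
    Set.finite_range _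
  -- Separate `x` from the compact hull; the coefficients of the separating functional are the
  -- weights that contradict the previous lemma.
  obtain ⟨f, u, v, h1, h2, h3⟩ := geometric_hahn_banach_compact_closed (convex_convexHull ℝ _)
    (hfin.isCompact_convexHull (𝕜 := ℝ)) (convex_singleton x) isClosed_singleton
    (Set.disjoint_singleton_right.2 hx)
  have hf : ∀ z : Fin n → ℝ, f z = ∑ i, z i * f (Pi.single i 1) := fun z => by
    conv_lhs => rw [← Finset.univ_sum_single z]
    rw [map_sum]
    refine Finset.sum_congr rfl fun i _ => ?_
    rw [← smul_eq_mul, ← map_smul, ← Pi.single_smul]; simp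
  obtain ⟨σ, hσ⟩ := sum_mul_le_sum_mul_of_majorizes h fun i => f (Pi.single i 1)
  have h4 := h1 _ (subset_convexHull ℝ _ ⟨σ, rfl⟩)
  have h5 := h3 x rfl
  rw [hf] at h4 h5
  linarith

/-! ### Product integrals and densities. -/

/-- Tonelli's theorem for a product of functions of the separate coordinates. -/
theorem lintegral_pi_prod_eq_prod {n : ℕ} {Ω : Type*} [MeasurableSpace Ω]
    {μ : Fin n → Measure Ω} [∀ i, SigmaFinite (μ i)]
    {f : Fin n → Ω → ℝ≥0∞} (hf : ∀ i, Measurable (f i)) :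
    ∫⁻ x : Fin n → Ω, ∏ i, f i (x i) ∂(Measure.pi μ) = ∏ i, ∫⁻ x, f i x ∂(μ i) := by
  induction n with
  | zero => simp
  | succ n ih =>
    have h := (measurePreserving_piFinSuccAbove μ 0).symm
    rw [← h.lintegral_comp_emb (MeasurableEquiv.measurableEmbedding _), Fin.prod_univ_succ,
      ← ih fun i => hf i.succ]
    refine Eq.trans ?_ (lintegral_prod_mul (hf 0).aemeasurable (Finset.measurable_prod _ fun i _ =>
      (hf i.succ).comp (measurable_pi_apply i)).aemeasurable)
    refine lintegral_congr fun x => ?_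
    rw [Fin.prod_univ_succ]
    rfl

/-- A product of measures with densities has the product density. -/
theorem pi_withDensity_eq {n : ℕ} (f : Fin n → ℝ → ℝ≥0∞) (hf : ∀ i, Measurable (f i))
    [∀ i, SigmaFinite (volume.withDensity (f i))] :
    Measure.pi (fun i => volume.withDensity (f i)) =
      (volume : Measure (Fin n → ℝ)).withDensity fun x => ∏ i, f i (x i) := by
  refine Measure.pi_eq fun s hs => ?_
  rw [withDensity_apply _ (MeasurableSet.univ_pi hs), volume_pi, Measure.restrict_pi_pi,
    lintegral_pi_prod_eq_prod hf]
  exact Finset.prod_congr rfl fun i _ => (withDensity_apply _ (hs i)).symm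

/-! ### Concavity in the squares, and the Gaussian case. -/

/-- `Φ` is concave as a function of the squares of the coordinates. -/
def SquareConcave {n : ℕ} (Φ : (Fin n → ℝ) → ℝ≥0∞) : Prop :=
  ∀ (a b c : Fin n → ℝ) (u v : ℝ), 0 ≤ u → 0 ≤ v → u + v = 1 →
    (∀ j, c j ^ 2 = u * a j ^ 2 + v * b j ^ 2) →
    ENNReal.ofReal u * Φ a + ENNReal.ofReal v * Φ b ≤ Φ c

lemma SquareConcave.lintegral {n : ℕ} {Ω : Type*} [MeasurableSpace Ω] {m : Measure Ω}
    {Φ : Ω → (Fin n → ℝ) → ℝ≥0∞} (hm : ∀ a, Measurable fun ω => Φ ω a)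
    (h : ∀ᵐ ω ∂m, SquareConcave (Φ ω)) : SquareConcave fun a => ∫⁻ ω, Φ ω a ∂m := by
  intro a b c u v hu hv huv hc
  rw [← lintegral_const_mul _ (hm a), ← lintegral_const_mul _ (hm b),
    ← lintegral_add_left ((hm a).const_mul _)]
  refine lintegral_mono_ae ?_
  filter_upwards [h] with ω hω using hω a b c u v hu hv huv hc

lemma SquareConcave.of_tendsto {n : ℕ} {Φ : ℕ → (Fin n → ℝ) → ℝ≥0∞} {Ψ : (Fin n → ℝ) → ℝ≥0∞}
    (h : ∀ k, SquareConcave (Φ k))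
    (ht : ∀ a, Filter.Tendsto (fun k => Φ k a) Filter.atTop (nhds (Ψ a))) : SquareConcave Ψ := by
  intro a b c u v hu hv huv hc
  refine le_of_tendsto_of_tendsto' (Filter.Tendsto.add
    (ENNReal.Tendsto.const_mul (ht a) (Or.inr ENNReal.ofReal_ne_top))
    (ENNReal.Tendsto.const_mul (ht b) (Or.inr ENNReal.ofReal_ne_top))) (ht c)
    fun k => h k a b c u v hu hv huv hc

/-- `∫ |⟪w, z⟫| e^{-|z|²} dz` is proportional to `|w|`. -/
lemma exists_lintegral_inner_gaussian (E : Type*) [NormedAddCommGroup E] [InnerProductSpace ℝ E]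
    [MeasurableSpace E] [BorelSpace E] [FiniteDimensional ℝ E] :
    ∃ C : ℝ≥0∞, ∀ w : E,
      ∫⁻ z : E, ENNReal.ofReal (|inner ℝ w z| * Real.exp (-‖z‖ ^ 2)) = ENNReal.ofReal ‖w‖ * C := by
  rcases subsingleton_or_nontrivial E with hE | hE
  · exact ⟨0, fun w => by simp [Subsingleton.elim w 0]⟩
  obtain ⟨e, he⟩ := exists_norm_eq E zero_le_one
  refine ⟨∫⁻ z : E, ENNReal.ofReal (|inner ℝ e z| * Real.exp (-‖z‖ ^ 2)), fun w => ?_⟩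
  have hn : ‖w‖ = ‖(‖w‖ • e)‖ := by simp [norm_smul, he]
  -- This reflection carries `w` to `‖w‖ • e` and preserves both the measure and the Gaussian
  -- weight, so only `‖w‖` matters.
  set ρ := (ℝ ∙ (w - ‖w‖ • e))ᗮ.reflection
  have hρ : ρ w = ‖w‖ • e := Submodule.reflection_sub hn
  rw [← lintegral_const_mul _ (by fun_prop), ← ρ.measurePreserving.lintegral_comp (by fun_prop)]
  refine lintegral_congr fun z => ?_
  rw [← ENNReal.ofReal_mul (norm_nonneg _), ρ.norm_map, ← mul_assoc, ← ρ.inner_map_map w (ρ z), hρ,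
    Submodule.reflection_reflection, inner_smul_left, abs_mul]
  simp

/-- The substitution `y_j = z_j / √(s_j)` reduces to the standard Gaussian and the vector `a_j /
√(s_j)`. It matters that `C` does not depend on `a`. -/
lemma lintegral_pi_gaussian {n : ℕ} (s : Fin n → ℝ) (hs : ∀ j, 0 < s j) :
    ∃ C : ℝ≥0∞, ∀ a : Fin n → ℝ,
      ∫⁻ y : Fin n → ℝ, ENNReal.ofReal (|∑ j, a j * y j| * ∏ j, Real.exp (-(s j * y j ^ 2))) =
        ENNReal.ofReal √(∑ j, a j ^ 2 / s j) * C := by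
  obtain ⟨C, hC⟩ := exists_lintegral_inner_gaussian (EuclideanSpace ℝ (Fin n))
  set D : Fin n → ℝ := fun j => (√(s j))⁻¹
  have hD : (Matrix.diagonal D).det ≠ 0 := by
    rw [Matrix.det_diagonal]
    exact Finset.prod_ne_zero_iff.2 fun j _ => inv_ne_zero (Real.sqrt_pos.2 (hs j)).ne'
  refine ⟨C * ENNReal.ofReal |(Matrix.diagonal D).det|, fun a => ?_⟩
  rw [← Real.smul_map_diagonal_volume_pi hD, lintegral_smul_measure,
    lintegral_map (by fun_prop) (LinearMap.continuous_on_pi _).measurable, smul_eq_mul,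
    mul_comm, ← mul_assoc]
  congr 1
  have h1 := hC (WithLp.toLp 2 fun j => a j * D j)
  have h2 : ‖WithLp.toLp 2 fun j => a j * D j‖ = √(∑ j, a j ^ 2 / s j) := by
    rw [EuclideanSpace.norm_eq]
    congr 1
    refine Finset.sum_congr rfl fun j _ => ?_
    simp [D, mul_pow, Real.sq_sqrt (hs j).le, div_eq_mul_inv]
  rw [h2] at h1
  rw [← h1, ← (PiLp.volume_preserving_toLp (Fin n)).lintegral_comp (by fun_prop)]
  refine lintegral_congr fun z => ?_
  congr 2
  · simp [PiLp.inner_apply, Matrix.toLin'_apply, Matrix.mulVec_diagonal, mul_comm, mul_left_comm]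
  · rw [← Real.exp_sum, EuclideanSpace.norm_sq_eq, ← Finset.sum_neg_distrib]
    congr 1
    refine Finset.sum_congr rfl fun j _ => ?_
    simp only [Matrix.toLin'_apply, Matrix.mulVec_diagonal, D, mul_pow, inv_pow,
      Real.sq_sqrt (hs j).le, Real.norm_eq_abs, sq_abs]
    field_simp [(hs j).ne']

lemma squareConcave_gaussian {n : ℕ} (s : Fin n → ℝ) (hs : ∀ j, 0 < s j) :
    SquareConcave fun a : Fin n → ℝ =>
      ∫⁻ y : Fin n → ℝ,
        ENNReal.ofReal (|∑ j, a j * y j| * ∏ j, Real.exp (-(s j * y j ^ 2))) := by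
  obtain ⟨C, hC⟩ := lintegral_pi_gaussian s hs
  intro a b c u v hu hv huv hc
  simp only [hC]
  rw [← mul_assoc, ← mul_assoc, ← add_mul, ← ENNReal.ofReal_mul hu, ← ENNReal.ofReal_mul hv,
    ← ENNReal.ofReal_add (by positivity) (by positivity)]
  gcongr
  apply Real.le_sqrt_of_sq_le
  have ha : 0 ≤ ∑ j, a j ^ 2 / s j := Finset.sum_nonneg fun j _ => by have := hs j; positivity
  have hb : 0 ≤ ∑ j, b j ^ 2 / s j := Finset.sum_nonneg fun j _ => by have := hs j; positivity
  have e : ∑ j, c j ^ 2 / s j = u * ∑ j, a j ^ 2 / s j + v * ∑ j, b j ^ 2 / s j := by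
    rw [Finset.mul_sum, Finset.mul_sum, ← Finset.sum_add_distrib]
    exact Finset.sum_congr rfl fun j _ => by rw [hc]; ring
  rw [e]
  set x := √(∑ j, a j ^ 2 / s j)
  set y := √(∑ j, b j ^ 2 / s j)
  rw [← Real.sq_sqrt ha, ← Real.sq_sqrt hb]
  change _ ≤ u * x ^ 2 + v * y ^ 2
  -- The remaining gap is exactly `u v (x - y)²`: concavity of the square root.
  obtain rfl : v = 1 - u := by linarith
  nlinarith [mul_nonneg (mul_nonneg hu hv) (sq_nonneg (x - y))]

/-! ### Gaussian mixtures and passage to the limit. -/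

/-- The integral of `|∑ a_j y_j|` against the product density `∏ F(y_j)`. -/
noncomputable def weightedAbs {n : ℕ} (F : ℝ → ℝ) (a : Fin n → ℝ) : ℝ≥0∞ :=
  ∫⁻ y : Fin n → ℝ, ENNReal.ofReal (|∑ j, a j * y j| * ∏ j, F (y j))

lemma ae_forall_ne_zero (n : ℕ) : ∀ᵐ y : Fin n → ℝ, ∀ j, y j ≠ 0 :=
  ae_all_iff.2 fun j => Measure.ae_eval_ne (fun _ => volume) j 0

/-- `F` is, away from the origin, a mixture of centred Gaussian densities. -/
def IsGaussianMixture (F : ℝ → ℝ) : Prop :=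
  ∃ (Ω : Type) (_ : MeasurableSpace Ω) (m : Measure Ω) (_ : SigmaFinite m) (S : Ω → ℝ),
    Measurable S ∧ (∀ ω, 0 ≤ S ω) ∧ ∀ y ≠ 0, 0 ≤ F y ∧
      ENNReal.ofReal (F y) = ∫⁻ ω, ENNReal.ofReal (Real.exp (-(S ω * y ^ 2))) ∂m

lemma IsGaussianMixture.const {k : ℝ} (hk : 0 ≤ k) : IsGaussianMixture fun _ => k := by
  refine ⟨Unit, inferInstance, k.toNNReal • Measure.dirac (), inferInstance, fun _ => 0,
    measurable_const, fun _ => le_rfl, fun y _ => ⟨hk, ?_⟩⟩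
  rw [lintegral_smul_measure]
  simp [ENNReal.ofReal, ENNReal.smul_def]

lemma IsGaussianMixture.mul {F G : ℝ → ℝ} (hF : IsGaussianMixture F) (hG : IsGaussianMixture G) :
    IsGaussianMixture fun y => F y * G y := by
  obtain ⟨Ω, _, m, _, S, hS, hS0, h⟩ := hF
  obtain ⟨Ω', _, m', _, S', hS', hS0', h'⟩ := hG
  refine ⟨Ω × Ω', inferInstance, m.prod m', inferInstance, fun ω => S ω.1 + S' ω.2, by fun_prop,
    fun ω => add_nonneg (hS0 _) (hS0' _), fun y hy =>
    ⟨mul_nonneg (h y hy).1 (h' y hy).1, ?_⟩⟩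
  rw [ENNReal.ofReal_mul (h y hy).1, (h y hy).2, (h' y hy).2,
    ← lintegral_prod_mul (by fun_prop) (by fun_prop)]
  refine lintegral_congr fun ω => ?_
  rw [← ENNReal.ofReal_mul (Real.exp_nonneg _), ← Real.exp_add]
  ring_nf

lemma IsGaussianMixture.pow {F : ℝ → ℝ} (hF : IsGaussianMixture F) :
    ∀ k : ℕ, IsGaussianMixture fun y => F y ^ k
  | 0 => by simpa using IsGaussianMixture.const zero_le_one
  | k + 1 => by simpa only [pow_succ] using (hF.pow k).mul hF

lemma IsGaussianMixture.comp_mul {F : ℝ → ℝ} (hF : IsGaussianMixture F) {k : ℝ} (hk : k ≠ 0) :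
    IsGaussianMixture fun y => F (k * y) := by
  obtain ⟨Ω, _, m, _, S, hS, hS0, h⟩ := hF
  refine ⟨Ω, inferInstance, m, inferInstance, fun ω => S ω * k ^ 2, by fun_prop,
    fun ω => mul_nonneg (hS0 _) (sq_nonneg _), fun y hy => ?_⟩
  simpa only [mul_pow, mul_assoc] using h (k * y) (mul_ne_zero hk hy)

/-- A mixture against a weight `ρ` on a set of positive parameters. -/
lemma IsGaussianMixture.of_weight {t : Set ℝ} (ht : MeasurableSet t) (ht0 : ∀ s ∈ t, 0 ≤ s)
    {ρ : ℝ → ℝ} (hρm : Measurable ρ) (hρ : ∀ s ∈ t, 0 ≤ ρ s) {F : ℝ → ℝ}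
    (hint : ∀ y ≠ 0, IntegrableOn (fun s => ρ s * Real.exp (-(s * y ^ 2))) t)
    (hF : ∀ y ≠ 0, F y = ∫ s in t, ρ s * Real.exp (-(s * y ^ 2))) : IsGaussianMixture F := by
  -- The rate is `|s|` so that it is nonnegative everywhere; it equals `s` on `t`.
  refine ⟨ℝ, inferInstance, (volume.restrict t).withDensity fun s => ENNReal.ofReal (ρ s),
    SigmaFinite.withDensity_ofReal _, fun s => |s|, by fun_prop, fun s => abs_nonneg s,
    fun y hy => ?_⟩
  have h0 : 0 ≤ᵐ[volume.restrict t] fun s => ρ s * Real.exp (-(s * y ^ 2)) :=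
    (ae_restrict_mem ht).mono fun s hs => mul_nonneg (hρ s hs) (Real.exp_nonneg _)
  rw [hF y hy]
  refine ⟨integral_nonneg_of_ae h0, ?_⟩
  rw [ofReal_integral_eq_lintegral_ofReal (hint y hy) h0,
    lintegral_withDensity_eq_lintegral_mul _ (by fun_prop) (by fun_prop)]
  refine setLIntegral_congr_fun ht fun s hs => ?_
  simp only [Pi.mul_apply]
  rw [ENNReal.ofReal_mul (hρ s hs), abs_of_nonneg (ht0 s hs)]

/-- Expanding every factor makes the product weight a mixture over `Fin n → Ω` of Gaussians with
rates `δ + S (ω j)`, so Tonelli reduces to the Gaussian case. Since `S` may vanish, `δ` is what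
keeps the rates positive. -/
lemma IsGaussianMixture.squareConcave {n : ℕ} {F : ℝ → ℝ} (hF : IsGaussianMixture F) {δ : ℝ}
    (hδ : 0 < δ) : SquareConcave
      fun a : Fin n → ℝ => weightedAbs (fun y => Real.exp (-(δ * y ^ 2)) * F y) a := by
  obtain ⟨Ω, _, m, _, S, hS, hS0, h⟩ := hF
  have key : ∀ a : Fin n → ℝ, weightedAbs (fun y => Real.exp (-(δ * y ^ 2)) * F y) a =
      ∫⁻ ω : Fin n → Ω, (∫⁻ y : Fin n → ℝ,
        ENNReal.ofReal (|∑ j, a j * y j| * ∏ j, Real.exp (-((δ + S (ω j)) * y j ^ 2))))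
        ∂(Measure.pi fun _ => m) := fun a => by
    rw [← lintegral_lintegral_swap (Measurable.aemeasurable (by
      simp only [Function.uncurry_def]; fun_prop))]
    refine lintegral_congr_ae ?_
    filter_upwards [ae_forall_ne_zero n] with y hy
    simp_rw [ENNReal.ofReal_mul (abs_nonneg _)]
    rw [lintegral_const_mul _ (by fun_prop)]
    congr 1
    rw [ENNReal.ofReal_prod_of_nonneg fun j _ =>
      mul_nonneg (Real.exp_nonneg _) (h (y j) (hy j)).1]
    have e : ∀ ω : Fin n → Ω,
        ENNReal.ofReal (∏ j, Real.exp (-((δ + S (ω j)) * y j ^ 2))) =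
        ∏ j, ENNReal.ofReal (Real.exp (-((δ + S (ω j)) * y j ^ 2))) := fun ω =>
      ENNReal.ofReal_prod_of_nonneg fun j _ => Real.exp_nonneg _
    simp_rw [e]
    rw [lintegral_pi_prod_eq_prod (μ := fun _ => m)
      (f := fun j ω => ENNReal.ofReal (Real.exp (-((δ + S ω) * y j ^ 2)))) fun j => by fun_prop]
    refine Finset.prod_congr rfl fun j _ => ?_
    rw [ENNReal.ofReal_mul (Real.exp_nonneg _), (h (y j) (hy j)).2,
      ← lintegral_const_mul _ (by fun_prop)]
    refine lintegral_congr fun ω => ?_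
    rw [← ENNReal.ofReal_mul (Real.exp_nonneg _), ← Real.exp_add]
    ring_nf
  simp_rw [key]
  refine SquareConcave.lintegral (fun a => ?_) (ae_of_all _ fun ω =>
    squareConcave_gaussian (fun j => δ + S (ω j)) fun j => by have := hS0 (ω j); positivity)
  exact Measurable.lintegral_prod_right (by simp only [Function.uncurry_def]; fun_prop)

lemma tendsto_weightedAbs {n : ℕ} {F : ℕ → ℝ → ℝ} {G B : ℝ → ℝ} (hm : ∀ k, Measurable (F k))
    (h0 : ∀ k, ∀ y ≠ 0, 0 ≤ F k y) (hB : ∀ k, ∀ y ≠ 0, F k y ≤ B y)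
    (hlim : ∀ y ≠ 0, Filter.Tendsto (fun k => F k y) Filter.atTop (nhds (G y)))
    (a : Fin n → ℝ) (hfin : weightedAbs B a ≠ ∞) :
    Filter.Tendsto (fun k => weightedAbs (F k) a) Filter.atTop (nhds (weightedAbs G a)) := by
  refine tendsto_lintegral_of_dominated_convergence
    (fun y : Fin n → ℝ => ENNReal.ofReal (|∑ j, a j * y j| * ∏ j, B (y j)))
    (fun k => ?_) (fun k => ?_) hfin ?_
  · have := hm k
    fun_prop
  · filter_upwards [ae_forall_ne_zero n] with y hy
    exact ENNReal.ofReal_le_ofReal (mul_le_mul_of_nonneg_left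
      (Finset.prod_le_prod (fun j _ => h0 k _ (hy j)) fun j _ => hB k _ (hy j)) (abs_nonneg _))
  · filter_upwards [ae_forall_ne_zero n] with y hy
    exact (ENNReal.continuous_ofReal.tendsto _).comp
      ((tendsto_finsetProd _ fun j _ => hlim _ (hy j)).const_mul _)

lemma integrable_abs_rpow_mul_exp {r q b : ℝ} (hr : -1 < r) (hq : 0 < q) (hb : 0 < b) :
    Integrable fun y : ℝ => |y| ^ r * Real.exp (-(b * |y| ^ q)) := by
  have h : IntegrableOn (fun y : ℝ => |y| ^ r * Real.exp (-(b * |y| ^ q))) (Set.Ioi 0) := by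
    refine (integrableOn_rpow_mul_exp_neg_mul_rpow hr hq hb).congr_fun (fun y hy => ?_)
      measurableSet_Ioi
    simp only [abs_of_pos (Set.mem_Ioi.1 hy), neg_mul]
  rw [← integrableOn_univ, ← @Set.Iio_union_Ici _ _ (0 : ℝ), integrableOn_union,
    integrableOn_Ici_iff_integrableOn_Ioi]
  refine ⟨?_, h⟩
  rw [← (Measure.measurePreserving_neg (volume : Measure ℝ)).integrableOn_comp_preimage
      (Homeomorph.neg ℝ).measurableEmbedding]
  simpa [Function.comp_def] using h

/-- By `|∑ a_i y_i| ≤ ∑ |a_i| |y_i|` the integral is at most a finite sum of products of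
one-dimensional integrals. Finiteness is needed both for dominated convergence and to pass to
real-valued concave functions. -/
lemma weightedAbs_ne_top {n : ℕ} {r q b : ℝ} (hr : -1 < r) (hq : 0 < q) (hb : 0 < b)
    (a : Fin n → ℝ) :
    weightedAbs (fun y => |y| ^ r * Real.exp (-(b * |y| ^ q))) a ≠ ∞ := by
  set B : ℝ → ℝ := fun y => |y| ^ r * Real.exp (-(b * |y| ^ q)) with hBdef
  have hB0 : ∀ y, 0 ≤ B y := fun y => by positivity
  have hBm : Measurable B := by fun_prop
  let D : Fin n → Fin n → ℝ → ℝ≥0∞ := fun i j y =>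
    ENNReal.ofReal ((if i = j then |y| else 1) * B y)
  have hDm : ∀ i j, Measurable (D i j) := fun i j => by
    dsimp only [D]; split_ifs <;> fun_prop
  have hD : ∀ i j, ∫⁻ y, D i j y ≠ ∞ := fun i j => by
    have hi : Integrable fun y => (if i = j then |y| else 1) * B y := by
      split_ifs
      · refine (integrable_abs_rpow_mul_exp (r := 1 + r) (by linarith) hq hb).congr ?_
        filter_upwards [Measure.ae_ne volume (0 : ℝ)] with y hy
        rw [hBdef, Real.rpow_add (abs_pos.2 hy), Real.rpow_one, mul_assoc]
      · simpa using integrable_abs_rpow_mul_exp hr hq hb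
    exact (hasFiniteIntegral_iff_ofReal (ae_of_all _ fun y => by
      split_ifs <;> have := hB0 y <;> positivity)).1 hi.2 |>.ne
  have hle : weightedAbs B a ≤
      ∫⁻ y : Fin n → ℝ, ∑ i, ENNReal.ofReal |a i| * ∏ j, D i j (y j) := by
    refine lintegral_mono fun y => ?_
    have e : ∀ i, ENNReal.ofReal |a i| * ∏ j, D i j (y j) =
        ENNReal.ofReal (|a i| * (|y i| * ∏ j, B (y j))) := fun i => by
      rw [ENNReal.ofReal_mul (abs_nonneg _), ← ENNReal.ofReal_prod_of_nonneg fun j _ => by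
        split_ifs <;> have := hB0 (y j) <;> positivity, Finset.prod_mul_distrib]
      simp
    simp_rw [e]
    rw [← ENNReal.ofReal_sum_of_nonneg fun i _ => mul_nonneg (abs_nonneg _)
      (mul_nonneg (abs_nonneg _) (Finset.prod_nonneg fun j _ => hB0 _))]
    refine ENNReal.ofReal_le_ofReal ?_
    simp_rw [← mul_assoc]
    rw [← Finset.sum_mul]
    refine mul_le_mul_of_nonneg_right ?_ (Finset.prod_nonneg fun j _ => hB0 _)
    simpa only [abs_mul] using Finset.abs_sum_le_sum_abs (fun i => a i * y i) Finset.univ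
  refine ne_top_of_le_ne_top ?_ hle
  have hPm : ∀ i, Measurable fun y : Fin n → ℝ => ∏ j, D i j (y j) := fun i =>
    Finset.measurable_prod _ fun j _ => (hDm i j).comp (measurable_pi_apply j)
  rw [lintegral_finsetSum _ fun i _ => (hPm i).const_mul _]
  refine ENNReal.sum_ne_top.2 fun i _ => ?_
  rw [lintegral_const_mul _ (hPm i), volume_pi, lintegral_pi_prod_eq_prod (hDm i)]
  exact ENNReal.mul_ne_top ENNReal.ofReal_ne_top (ENNReal.prod_ne_top fun j _ => hD i j)

/-! ### Stable laws as limits of Pareto sums. -/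

/-- The Laplace transform of the Pareto distribution of index `α`. -/
noncomputable def paretoLaplace (α t : ℝ) : ℝ :=
  ∫ s in Set.Ioi (1 : ℝ), α * s ^ (-1 - α) * Real.exp (-(s * t))

/-- The density whose tail integrals measure how fast `paretoLaplace α` leaves `1`. -/
noncomputable def paretoDefect (α r : ℝ) : ℝ := (1 - Real.exp (-r)) * (α * r ^ (-1 - α))

lemma integrableOn_pareto {α t : ℝ} (hα : 0 < α) (ht : 0 ≤ t) :
    IntegrableOn (fun s : ℝ => α * s ^ (-1 - α) * Real.exp (-(s * t))) (Set.Ioi 1) := by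
  refine Integrable.mono' ((integrableOn_Ioi_rpow_of_lt (a := -1 - α) (by linarith)
    one_pos).const_mul α) (by fun_prop) ?_
  filter_upwards [ae_restrict_mem measurableSet_Ioi] with s hs
  have hs0 : (0 : ℝ) < s := one_pos.trans hs
  rw [Real.norm_of_nonneg (by positivity)]
  exact mul_le_of_le_one_right (by positivity) (Real.exp_le_one_iff.2 (by
    have := mul_nonneg hs0.le ht; linarith))

lemma paretoLaplace_nonneg {α : ℝ} (hα : 0 < α) (t : ℝ) : 0 ≤ paretoLaplace α t :=
  setIntegral_nonneg measurableSet_Ioi fun s hs => by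
    have hs0 : (0 : ℝ) < s := one_pos.trans hs
    positivity

lemma paretoDefect_pos {α r : ℝ} (hα : 0 < α) (hr : 0 < r) : 0 < paretoDefect α r :=
  mul_pos (sub_pos.2 (Real.exp_lt_one_iff.2 (by linarith))) (by positivity)

lemma integrableOn_paretoDefect {α : ℝ} (hα : 0 < α) (hα1 : α < 1) :
    IntegrableOn (paretoDefect α) (Set.Ioi 0) := by
  have hm : Measurable (paretoDefect α) := by unfold paretoDefect; fun_prop
  rw [← Set.Ioc_union_Ioi_eq_Ioi zero_le_one, integrableOn_union]
  constructor
  · have h := (intervalIntegrable_iff_integrableOn_Ioc_of_le zero_le_one).1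
      (intervalIntegral.intervalIntegrable_rpow' (a := 0) (b := 1) (r := -α) (by linarith))
    refine Integrable.mono' (h.const_mul α) hm.aestronglyMeasurable ?_
    filter_upwards [ae_restrict_mem measurableSet_Ioc] with r hr
    rw [Real.norm_of_nonneg (paretoDefect_pos hα hr.1).le, paretoDefect,
      show -α = 1 + (-1 - α) by ring, Real.rpow_add hr.1, Real.rpow_one]
    have h1 : 1 - Real.exp (-r) ≤ r := by linarith [Real.one_sub_le_exp_neg r]
    have h2 : 0 ≤ α * r ^ (-1 - α) := by have := hr.1; positivity
    nlinarith [mul_le_mul_of_nonneg_right h1 h2]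
  · refine Integrable.mono' ((integrableOn_Ioi_rpow_of_lt (a := -1 - α) (by linarith)
      one_pos).const_mul α) hm.aestronglyMeasurable ?_
    filter_upwards [ae_restrict_mem measurableSet_Ioi] with r hr
    have hr0 : (0 : ℝ) < r := one_pos.trans hr
    rw [Real.norm_of_nonneg (paretoDefect_pos hα hr0).le, paretoDefect]
    exact mul_le_of_le_one_left (by positivity) (by linarith [Real.exp_pos (-r)])

lemma integral_paretoDefect_pos {α : ℝ} (hα : 0 < α) (hα1 : α < 1) :
    0 < ∫ r in Set.Ioi 0, paretoDefect α r := by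
  rw [setIntegral_pos_iff_support_of_nonneg_ae
    ((ae_restrict_mem measurableSet_Ioi).mono fun r hr => (paretoDefect_pos hα hr).le)
    (integrableOn_paretoDefect hα hα1)]
  have : Set.Ioi (0 : ℝ) ⊆ Function.support (paretoDefect α) ∩ Set.Ioi 0 := fun r hr =>
    ⟨(paretoDefect_pos hα hr).ne', hr⟩
  exact (by simp : (0 : ℝ≥0∞) < volume (Set.Ioi (0 : ℝ))).trans_le (measure_mono this)

/-- Substitute `r = t s` in `∫ (1 - e^{-st}) α s^{-1-α} ds`. As `t → 0` this gives `1 - L(t) ~ C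
t^α`, the asymptotics behind the stable limit. -/
lemma one_sub_paretoLaplace {α t : ℝ} (hα : 0 < α) (ht : 0 < t) :
    1 - paretoLaplace α t = t ^ α * ∫ r in Set.Ioi t, paretoDefect α r := by
  have h1 : (1 : ℝ) = ∫ s in Set.Ioi (1 : ℝ), α * s ^ (-1 - α) := by
    rw [integral_const_mul, integral_Ioi_rpow_of_lt (by linarith) one_pos, Real.one_rpow,
      show -1 - α + 1 = -α by ring]
    field_simp
  have h2 := integral_comp_mul_left_Ioi (paretoDefect α) 1 ht
  rw [mul_one, smul_eq_mul] at h2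
  have h3 : ∫ r in Set.Ioi t, paretoDefect α r =
      t * ∫ s in Set.Ioi (1 : ℝ), paretoDefect α (t * s) := by
    rw [h2, ← mul_assoc, mul_inv_cancel₀ ht.ne', one_mul]
  rw [h3, ← mul_assoc, ← integral_const_mul]
  nth_rw 1 [h1]
  rw [paretoLaplace, ← integral_sub
    ((integrableOn_Ioi_rpow_of_lt (a := -1 - α) (by linarith) one_pos).const_mul α)
    (integrableOn_pareto hα ht.le)]
  refine setIntegral_congr_fun measurableSet_Ioi fun s hs => ?_
  have hs0 : (0 : ℝ) < s := one_pos.trans hs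
  simp only [paretoDefect]
  have e : t ^ α * t * t ^ (-1 - α) = 1 := by
    nth_rw 2 [← Real.rpow_one t]
    rw [← Real.rpow_add ht, ← Real.rpow_add ht]
    ring_nf
    exact Real.rpow_zero t
  rw [Real.mul_rpow ht.le hs0.le, mul_comm s t]
  linear_combination (-(1 - Real.exp (-(t * s))) * (α * s ^ (-1 - α))) * e

/-- The stable limit theorem for the Pareto distribution, in terms of Laplace transforms. -/
lemma tendsto_paretoLaplace_pow {α x : ℝ} (hα : 0 < α) (hα1 : α < 1) (hx : 0 < x) :
    Filter.Tendsto (fun k : ℕ => paretoLaplace α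
      (x * (k * ∫ r in Set.Ioi 0, paretoDefect α r) ^ (-α⁻¹)) ^ k) Filter.atTop
      (nhds (Real.exp (-x ^ α))) := by
  set C := ∫ r in Set.Ioi 0, paretoDefect α r
  have hC : 0 < C := integral_paretoDefect_pos hα hα1
  set t : ℕ → ℝ := fun k => x * (k * C) ^ (-α⁻¹)
  have ht0 : Filter.Tendsto t Filter.atTop (nhds 0) := by
    have h1 : Filter.Tendsto (fun k : ℕ => (k : ℝ) * C) Filter.atTop Filter.atTop :=
      tendsto_natCast_atTop_atTop.atTop_mul_const hC
    simpa using ((tendsto_rpow_neg_atTop (inv_pos.2 hα)).comp h1).const_mul x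
  have hlim : Filter.Tendsto (fun k => ∫ r in Set.Ioi (t k), paretoDefect α r) Filter.atTop
      (nhds C) := by
    have h := (aecover_Ioi_of_Ioi (μ := volume) ht0).integral_tendsto_of_countably_generated
      (integrableOn_paretoDefect hα hα1)
    refine h.congr fun k => ?_
    have : 0 ≤ t k := by positivity
    rw [Measure.restrict_restrict measurableSet_Ioi, Set.Ioi_inter_Ioi, max_eq_left this]
  -- The scaling gives `t_k^α = x^α / (k C)`, hence `k (L(t_k) - 1) → -x^α`, and `(1 + g_k)^k` has
  -- the exponential limit.
  have h := Real.tendsto_one_add_pow_exp_of_tendsto (g := fun k => paretoLaplace α (t k) - 1)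
    (t := -x ^ α) ?_
  · simpa using h
  have h2 : Filter.Tendsto (fun k => -x ^ α * C⁻¹ * ∫ r in Set.Ioi (t k), paretoDefect α r)
      Filter.atTop (nhds (-x ^ α)) := by
    have := hlim.const_mul (-x ^ α * C⁻¹)
    rwa [mul_assoc (-x ^ α), inv_mul_cancel₀ hC.ne', mul_one] at this
  refine h2.congr' ?_
  filter_upwards [Filter.eventually_gt_atTop 0] with k hk
  have hk : (0 : ℝ) < k := by exact_mod_cast hk
  have ht : 0 < t k := by positivity
  have hta : t k ^ α = x ^ α * (k * C)⁻¹ := by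
    rw [Real.mul_rpow hx.le (by positivity), ← Real.rpow_mul (by positivity), neg_mul,
      inv_mul_cancel₀ hα.ne', Real.rpow_neg_one]
  have h3 := one_sub_paretoLaplace hα ht
  rw [hta] at h3
  rw [show paretoLaplace α (t k) - 1 = -(1 - paretoLaplace α (t k)) by ring, h3]
  field_simp

lemma paretoLaplace_le_one {α t : ℝ} (hα : 0 < α) (ht : 0 < t) : paretoLaplace α t ≤ 1 := by
  have h := one_sub_paretoLaplace hα ht
  have : 0 ≤ ∫ r in Set.Ioi t, paretoDefect α r :=
    setIntegral_nonneg measurableSet_Ioi fun r hr => (paretoDefect_pos hα (ht.trans hr)).le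
  have : 0 ≤ t ^ α * ∫ r in Set.Ioi t, paretoDefect α r := by positivity
  linarith

lemma measurable_paretoLaplace (α : ℝ) : Measurable (paretoLaplace α) := by
  have h : StronglyMeasurable fun t : ℝ =>
      ∫ s in Set.Ioi (1 : ℝ), α * s ^ (-1 - α) * Real.exp (-(s * t)) :=
    StronglyMeasurable.integral_prod_right (f := fun t s : ℝ =>
      α * s ^ (-1 - α) * Real.exp (-(s * t))) (Measurable.stronglyMeasurable (by
        simp only [Function.uncurry_def]; fun_prop))
  exact h.measurable

lemma isGaussianMixture_paretoLaplace {α : ℝ} (hα : 0 < α) :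
    IsGaussianMixture fun y => paretoLaplace α (y ^ 2) :=
  IsGaussianMixture.of_weight (t := Set.Ioi 1) (ρ := fun s => α * s ^ (-1 - α)) measurableSet_Ioi
    (fun _ hs => (one_pos.trans hs).le) (by fun_prop)
    (fun s hs => by have : (0 : ℝ) < s := one_pos.trans hs; positivity)
    (fun y _ => integrableOn_pareto hα (sq_nonneg y)) fun _ _ => rfl

/-! ### Concavity for the densities `|y|^{2α-2} e^{-|y|^{2α}}`. -/

/-- This is the Gamma integral `∫ s^{β-1} e^{-s y²} ds = Γ(β) |y|^{-2β}`. It diverges at `y = 0`,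
which is why mixtures are only required to represent `F` off the origin. -/
lemma isGaussianMixture_abs_rpow {β : ℝ} (hβ : 0 < β) :
    IsGaussianMixture fun y => |y| ^ (-2 * β) := by
  have hΓ := Real.Gamma_pos_of_pos hβ
  have hpow : ∀ y : ℝ, y ≠ 0 → (1 / y ^ 2) ^ β = |y| ^ (-2 * β) := fun y hy => by
    rw [← sq_abs, one_div, ← Real.rpow_natCast, ← Real.rpow_neg (abs_nonneg y),
      ← Real.rpow_mul (abs_nonneg y)]
    norm_num
  refine IsGaussianMixture.of_weight (t := Set.Ioi 0)
    (ρ := fun s => (Real.Gamma β)⁻¹ * s ^ (β - 1)) measurableSet_Ioi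
    (fun _ hs => le_of_lt hs) (by fun_prop)
    (fun s hs => by have : (0 : ℝ) < s := hs; positivity) (fun y hy => ?_) fun y hy => ?_
  · have h := integrableOn_rpow_mul_exp_neg_mul_rpow (p := 1) (s := β - 1) (b := y ^ 2)
      (by linarith) one_pos (by positivity)
    refine IntegrableOn.congr_fun (h.const_mul (Real.Gamma β)⁻¹) (fun s _ => ?_) measurableSet_Ioi
    simp only [Real.rpow_one]
    ring_nf
  · have h := Real.integral_rpow_mul_exp_neg_mul_Ioi hβ (r := y ^ 2) (by positivity)
    simp_rw [mul_assoc, integral_const_mul, mul_comm _ (y ^ 2)]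
    rw [h, hpow y hy]
    field_simp

/-- The integral of `|∑ a_j y_j|` against the product of the densities `|y|^{2α-2} e^{-|y|^{2α}}`
is a concave function of the squares of the `a_j`. -/
theorem squareConcave_weightedAbs {n : ℕ} {α : ℝ} (hα : 1 / 2 < α) (hα1 : α < 1) :
    SquareConcave fun a : Fin n → ℝ =>
      weightedAbs (fun y => |y| ^ (2 * α - 2) * Real.exp (-(1 * |y| ^ (2 * α)))) a := by
  have hα0 : 0 < α := by linarith
  set C := ∫ r in Set.Ioi 0, paretoDefect α r
  have hC : 0 < C := integral_paretoDefect_pos hα0 hα1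
  have hsq : ∀ y : ℝ, (y ^ 2) ^ α = |y| ^ (2 * α) := fun y => by
    rw [← sq_abs, ← Real.rpow_natCast, ← Real.rpow_mul (abs_nonneg y)]
    norm_num
  have hpl := measurable_paretoLaplace α
  -- The extra factor `e^{-δ y²}` gives positive Gaussian rates and an integrable bound uniform in
  -- `k`; it is removed at the end by letting `δ = 1/(k+1) → 0`.
  have main : ∀ δ : ℝ, 0 < δ → SquareConcave fun a : Fin n → ℝ => weightedAbs (fun y =>
      Real.exp (-(δ * y ^ 2)) * (|y| ^ (2 * α - 2) * Real.exp (-(|y| ^ (2 * α))))) a := by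
    intro δ hδ
    -- Indexing from `k + 1` keeps the scale `c k` positive.
    set c : ℕ → ℝ := fun k => ((k + 1 : ℕ) * C) ^ (-α⁻¹) with hc
    have hc0 : ∀ k, 0 < c k := fun k => by positivity
    refine SquareConcave.of_tendsto (Φ := fun k a => weightedAbs (fun y =>
      Real.exp (-(δ * y ^ 2)) *
        (|y| ^ (2 * α - 2) * paretoLaplace α (y ^ 2 * c k) ^ (k + 1))) a) (fun k => ?_)
      fun a => ?_
    · refine IsGaussianMixture.squareConcave (IsGaussianMixture.mul ?_ (IsGaussianMixture.pow ?_ _))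
        hδ
      · have := isGaussianMixture_abs_rpow (β := 1 - α) (by linarith)
        rwa [show -2 * (1 - α) = 2 * α - 2 by ring] at this
      · have h := (isGaussianMixture_paretoLaplace hα0).comp_mul (Real.sqrt_pos.2 (hc0 k)).ne'
        simpa only [mul_pow, Real.sq_sqrt (hc0 k).le, mul_comm] using h
    · refine tendsto_weightedAbs (B := fun y => |y| ^ (2 * α - 2) * Real.exp (-(δ * |y| ^ (2 : ℝ))))
        (fun k => by fun_prop) (fun k y _ => ?_) (fun k y hy => ?_) (fun y hy => ?_) a
        (weightedAbs_ne_top (by linarith) two_pos hδ a)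
      · have := paretoLaplace_nonneg hα0 (y ^ 2 * c k)
        positivity
      · rw [mul_comm, Real.rpow_two, sq_abs]
        have hck := hc0 k
        have h1 := pow_le_one₀ (n := k + 1) (paretoLaplace_nonneg hα0 (y ^ 2 * c k))
          (paretoLaplace_le_one hα0 (by positivity))
        exact mul_le_mul_of_nonneg_right (mul_le_of_le_one_right (by positivity) h1)
          (Real.exp_nonneg _)
      · have h := (tendsto_paretoLaplace_pow hα0 hα1 (x := y ^ 2) (by positivity)).comp
          (Filter.tendsto_add_atTop_nat 1)
        rw [hsq] at h
        exact (h.const_mul _).const_mul _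
  refine SquareConcave.of_tendsto (Φ := fun k a => weightedAbs (fun y =>
    Real.exp (-((1 / ((k : ℝ) + 1)) * y ^ 2)) *
      (|y| ^ (2 * α - 2) * Real.exp (-(|y| ^ (2 * α))))) a)
    (fun k => main _ Nat.one_div_pos_of_nat) fun a => ?_
  refine tendsto_weightedAbs (B := fun y => |y| ^ (2 * α - 2) * Real.exp (-(1 * |y| ^ (2 * α))))
    (fun k => by fun_prop) (fun k y _ => by positivity) (fun k y _ => ?_) (fun y hy => ?_) a
    (weightedAbs_ne_top (by linarith) (by linarith) one_pos a)
  · rw [one_mul]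
    refine mul_le_of_le_one_left (by positivity) (Real.exp_le_one_iff.2 ?_)
    have : 0 ≤ (1 / ((k : ℝ) + 1)) * y ^ 2 := by positivity
    linarith
  · have h : Filter.Tendsto (fun k : ℕ => Real.exp (-((1 / ((k : ℝ) + 1)) * y ^ 2))) Filter.atTop
        (nhds 1) := by
      have := (tendsto_one_div_add_atTop_nhds_zero_nat (𝕜 := ℝ)).mul_const (y ^ 2)
      simpa [Function.comp_def] using (Real.continuous_exp.tendsto _).comp this.neg
    simpa using h.mul_const (|y| ^ (2 * α - 2) * Real.exp (-(|y| ^ (2 * α))))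

/-! ### From concavity and symmetry to Schur concavity. -/

lemma weightedAbs_perm {n : ℕ} (F : ℝ → ℝ) (a : Fin n → ℝ) (σ : Equiv.Perm (Fin n)) :
    weightedAbs F (fun j => a (σ j)) = weightedAbs F a := by
  have h := measurePreserving_piCongrLeft (fun _ : Fin n => (volume : Measure ℝ)) σ
  unfold weightedAbs
  symm
  rw [volume_pi, ← h.lintegral_comp_emb (MeasurableEquiv.measurableEmbedding _)]
  refine lintegral_congr fun y => ?_
  simp only [MeasurableEquiv.coe_piCongrLeft]
  set z := Equiv.piCongrLeft (fun _ : Fin n => ℝ) σ y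
  have hz : ∀ i, z (σ i) = y i := fun i => Equiv.piCongrLeft_apply_apply (fun _ : Fin n => ℝ) σ y i
  rw [← Equiv.sum_comp σ fun j => a j * z j, ← Equiv.prod_comp σ fun j => F (z j)]
  simp only [hz]

lemma weightedAbs_const_mul {n : ℕ} {k : ℝ} (hk : 0 ≤ k) (F : ℝ → ℝ) (hF : Measurable F)
    (a : Fin n → ℝ) :
    weightedAbs (fun y => k * F y) a = ENNReal.ofReal (k ^ n) * weightedAbs F a := by
  unfold weightedAbs
  rw [← lintegral_const_mul _ (by fun_prop)]
  refine lintegral_congr fun y => ?_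
  rw [← ENNReal.ofReal_mul (by positivity), Finset.prod_mul_distrib, Finset.prod_const,
    Finset.card_univ, Fintype.card_fin]
  ring_nf

lemma SquareConcave.const_mul {n : ℕ} {Φ : (Fin n → ℝ) → ℝ≥0∞} (h : SquareConcave Φ) (k : ℝ≥0∞) :
    SquareConcave fun a => k * Φ a := fun a b c u v hu hv huv hc => by
  have := mul_le_mul_right (h a b c u v hu hv huv hc) k
  rw [mul_add] at this
  convert this using 2 <;> ring

/-- A symmetric function that is concave in the squares of the coordinates is Schur concave in
them. -/
theorem SquareConcave.le_of_majorizes {n : ℕ} {Φ : (Fin n → ℝ) → ℝ≥0∞} (h : SquareConcave Φ)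
    (hfin : ∀ a, Φ a ≠ ∞) (hperm : ∀ a (σ : Equiv.Perm (Fin n)), Φ (fun j => a (σ j)) = Φ a)
    {a b : Fin n → ℝ} (hab : Majorizes (fun j => b j ^ 2) (fun j => a j ^ 2)) : Φ b ≤ Φ a := by
  -- The degenerate weights `u = 1`, `v = 0` show that `Φ` depends only on the squares, so `t ↦
  -- Φ(√t)` loses no sign information.
  have hsq : ∀ a b : Fin n → ℝ, (∀ j, b j ^ 2 = a j ^ 2) → Φ a ≤ Φ b := fun a b hab => by
    simpa using h a a b 1 0 zero_le_one le_rfl (by simp) (by simpa using hab)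
  have hconc : ConcaveOn ℝ {t : Fin n → ℝ | ∀ j, 0 ≤ t j}
      fun t => (Φ fun j => √(t j)).toReal := by
    refine ⟨fun s hs t ht u v hu hv huv j => ?_, fun s hs t ht u v hu hv huv => ?_⟩
    · have h1 := hs j
      have h2 := ht j
      simp only [Pi.add_apply, Pi.smul_apply, smul_eq_mul]
      positivity
    · have h1 := h (fun j => √(s j)) (fun j => √(t j)) (fun j => √((u • s + v • t) j)) u v hu hv huv
        fun j => by
          have h1 := hs j
          have h2 := ht j
          simp only [Pi.add_apply, Pi.smul_apply, smul_eq_mul]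
          rw [Real.sq_sqrt (by positivity), Real.sq_sqrt h1, Real.sq_sqrt h2]
      have h2 := ENNReal.toReal_mono (hfin _) h1
      rwa [ENNReal.toReal_add (ENNReal.mul_ne_top ENNReal.ofReal_ne_top (hfin _))
        (ENNReal.mul_ne_top ENNReal.ofReal_ne_top (hfin _)), ENNReal.toReal_mul,
        ENNReal.toReal_mul, ENNReal.toReal_ofReal hu, ENNReal.toReal_ofReal hv] at h2
  -- At a point of a convex hull, a concave function is at least its value at some generator, here a
  -- permutation of the `b_j²`.
  obtain ⟨_, ⟨σ, rfl⟩, hσ⟩ := hconc.exists_le_of_mem_convexHull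
    (by rintro _ ⟨σ, rfl⟩ j; exact sq_nonneg _) (mem_convexHull_of_majorizes hab)
  have h1 := (ENNReal.toReal_le_toReal (hfin _) (hfin _)).1 hσ
  calc Φ b = Φ fun j => b (σ j) := (hperm b σ).symm
    _ ≤ Φ fun j => √(b (σ j) ^ 2) := hsq _ _ fun j => Real.sq_sqrt (sq_nonneg _)
    _ ≤ Φ fun j => √(a j ^ 2) := h1
    _ ≤ Φ a := hsq _ _ fun j => (Real.sq_sqrt (sq_nonneg _)).symm

/-! ### Change of variables to the conjugate exponent. -/

/-- The odd power function `x ↦ sign(x) |x|^{p-1}`. -/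
noncomputable def signedPow (p x : ℝ) : ℝ := |x| ^ (p - 2) * x

lemma measurable_signedPow (p : ℝ) : Measurable (signedPow p) := by
  unfold signedPow; fun_prop

lemma abs_signedPow (p : ℝ) {x : ℝ} (hx : x ≠ 0) : |signedPow p x| = |x| ^ (p - 1) := by
  rw [signedPow, abs_mul, abs_of_nonneg (by positivity : 0 ≤ |x| ^ (p - 2)),
    show p - 1 = (p - 2) + 1 by ring, Real.rpow_add (abs_pos.2 hx), Real.rpow_one]

lemma strictMono_signedPow {p : ℝ} (hp : 2 < p) : StrictMono (signedPow p) := by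
  refine strictMono_of_odd_strictMonoOn_nonneg (fun x => by simp [signedPow]) ?_
  intro x hx y hy hxy
  have hx : (0 : ℝ) ≤ x := hx
  have hy : 0 < y := hx.trans_lt hxy
  simp only [signedPow, abs_of_nonneg hx, abs_of_pos hy]
  exact mul_lt_mul' (Real.rpow_le_rpow hx hxy.le (by linarith)) hxy hx (by positivity)

lemma hasDerivAt_signedPow (p : ℝ) {x : ℝ} (hx : x ≠ 0) :
    HasDerivAt (signedPow p) ((p - 1) * |x| ^ (p - 2)) x := by
  have h := ((hasDerivAt_abs hx).rpow_const (p := p - 2) (Or.inl (abs_pos.2 hx).ne')).mul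
    (hasDerivAt_id x)
  refine h.congr_deriv ?_
  have e : (SignType.sign x : ℝ) * x = |x| := by rw [← sign_mul_abs x]; simp [mul_comm]
  have e2 : |x| ^ (p - 2) = |x| ^ (p - 2 - 1) * |x| := by
    nth_rw 3 [← Real.rpow_one |x|]
    rw [← Real.rpow_add (abs_pos.2 hx)]; ring_nf
  simp only [id, mul_one]
  rw [e2]
  linear_combination ((p - 2) * |x| ^ (p - 2 - 1)) * e

/-- For conjugate exponents the two odd powers are mutually inverse. -/
lemma signedPow_signedPow {p q x : ℝ} (hpq : (p - 1) * (q - 1) = 1) (hx : x ≠ 0) :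
    signedPow p (signedPow q x) = x := by
  rw [signedPow, abs_signedPow q hx, signedPow, ← Real.rpow_mul (abs_nonneg x), ← mul_assoc,
    ← Real.rpow_add (abs_pos.2 hx), show (q - 1) * (p - 2) + (q - 2) = 0 by linarith,
    Real.rpow_zero, one_mul]

/-- The law of `signedPow p` under the density `e^{-|x|^p}`. -/
lemma map_signedPow {p q : ℝ} (hp : 2 < p) (hpq : (p - 1) * (q - 1) = 1) :
    (volume.withDensity fun x => ENNReal.ofReal (Real.exp (-|x| ^ p))).map (signedPow p) =
      volume.withDensity fun y =>
        ENNReal.ofReal ((p - 1)⁻¹ * (|y| ^ (q - 2) * Real.exp (-(1 * |y| ^ q)))) := by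
  have hp1 : 0 < p - 1 := by linarith
  ext s hs
  rw [Measure.map_apply (measurable_signedPow p) hs,
    withDensity_apply _ (measurable_signedPow p hs), withDensity_apply _ hs,
    ← lintegral_indicator (measurable_signedPow p hs), ← lintegral_indicator hs]
  set g : ℝ → ℝ≥0∞ := s.indicator fun y =>
    ENNReal.ofReal ((p - 1)⁻¹ * (|y| ^ (q - 2) * Real.exp (-(1 * |y| ^ q))))
  have himg : signedPow p '' {0}ᶜ = {0}ᶜ := by
    ext y
    constructor
    · rintro ⟨x, hx, rfl⟩ h0
      have h0 : signedPow p x = 0 := h0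
      exact hx ((strictMono_signedPow hp).injective (h0.trans (by simp [signedPow])))
    · intro hy
      have hy : y ≠ 0 := hy
      exact ⟨signedPow q y, mul_ne_zero (by positivity) hy, signedPow_signedPow hpq hy⟩
  have hae : ({0}ᶜ : Set ℝ) =ᵐ[volume] Set.univ :=
    Filter.eventuallyEq_univ.2 (compl_mem_ae_iff.2 (by simp))
  have hcv := lintegral_image_eq_lintegral_abs_deriv_mul (s := {0}ᶜ) (f := signedPow p)
    (f' := fun x => (p - 1) * |x| ^ (p - 2)) (measurableSet_singleton 0).compl
    (fun x hx => (hasDerivAt_signedPow p hx).hasDerivWithinAt)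
    (strictMono_signedPow hp).injective.injOn g
  rw [himg, setLIntegral_congr hae, setLIntegral_univ] at hcv
  rw [hcv, ← setLIntegral_univ, ← setLIntegral_congr hae]
  refine setLIntegral_congr_fun (measurableSet_singleton 0).compl fun x hx => ?_
  have hx : x ≠ 0 := hx
  have hx' := abs_pos.2 hx
  by_cases hxs : signedPow p x ∈ s
  · simp only [g]
    rw [Set.indicator_of_mem hxs, Set.indicator_of_mem (Set.mem_preimage.2 hxs),
      ← ENNReal.ofReal_mul (abs_nonneg _), abs_of_nonneg (by positivity : 0 ≤ (p - 1) * |x| ^ (p - 2))]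
    congr 1
    -- With `y = signedPow p x`, conjugacy gives `|y|^q = |x|^p` and `|y|^{q-2} = |x|^{-(p-2)}`, so
    -- the density cancels the Jacobian.
    rw [abs_signedPow p hx, ← Real.rpow_mul hx'.le, ← Real.rpow_mul hx'.le,
      show (p - 1) * (q - 2) = -(p - 2) by linarith, show (p - 1) * q = p by linarith,
      Real.rpow_neg hx'.le, one_mul]
    have : |x| ^ (p - 2) ≠ 0 := by positivity
    field_simp
  · simp only [g]
    rw [Set.indicator_of_notMem hxs, Set.indicator_of_notMem (by exact hxs), mul_zero]

/-- The integral of `|∑ a_j sign(x_j)|x_j|^{p-1}|` against the density `e^{-∑|x_j|^p}`. -/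
noncomputable def powerAbs {n : ℕ} (p : ℝ) (a : Fin n → ℝ) : ℝ≥0∞ :=
  ∫⁻ x : Fin n → ℝ, ENNReal.ofReal (|∑ j, a j * signedPow p (x j)| * ∏ j, Real.exp (-|x j| ^ p))

lemma lintegral_pi_withDensity_ofReal {n : ℕ} {F : ℝ → ℝ} (hF : Measurable F) (hF0 : ∀ y, 0 ≤ F y)
    {g : (Fin n → ℝ) → ℝ} (hg : Measurable g) (hg0 : ∀ y, 0 ≤ g y) :
    ∫⁻ y, ENNReal.ofReal (g y)
      ∂Measure.pi (fun _ : Fin n => volume.withDensity fun y => ENNReal.ofReal (F y)) =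
      ∫⁻ y, ENNReal.ofReal (g y * ∏ j, F (y j)) := by
  have : SigmaFinite ((volume : Measure ℝ).withDensity fun y => ENNReal.ofReal (F y)) :=
    SigmaFinite.withDensity_ofReal _
  rw [pi_withDensity_eq _ fun _ => by fun_prop,
    lintegral_withDensity_eq_lintegral_mul _ (by fun_prop) (by fun_prop)]
  refine lintegral_congr fun y => ?_
  simp only [Pi.mul_apply]
  rw [ENNReal.ofReal_mul (hg0 y), ENNReal.ofReal_prod_of_nonneg fun j _ => hF0 _, mul_comm]

lemma powerAbs_eq_weightedAbs {n : ℕ} {p q : ℝ} (hp : 2 < p) (hpq : (p - 1) * (q - 1) = 1)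
    (a : Fin n → ℝ) : powerAbs p a =
      weightedAbs (fun y => (p - 1)⁻¹ * (|y| ^ (q - 2) * Real.exp (-(1 * |y| ^ q)))) a := by
  have hp1 : 0 < p - 1 := by linarith
  have hm := measurable_signedPow p
  rw [powerAbs, weightedAbs, ← lintegral_pi_withDensity_ofReal (F := fun y => Real.exp (-|y| ^ p))
    (by fun_prop) (fun _ => Real.exp_nonneg _)
    (g := fun x : Fin n → ℝ => |∑ j, a j * signedPow p (x j)|)
    (by fun_prop) (fun _ => abs_nonneg _), ← lintegral_pi_withDensity_ofReal
    (F := fun y => (p - 1)⁻¹ * (|y| ^ (q - 2) * Real.exp (-(1 * |y| ^ q)))) (by fun_prop)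
    (fun y => by positivity) (g := fun y : Fin n → ℝ => |∑ j, a j * y j|) (by fun_prop) (fun _ => abs_nonneg _), ← map_signedPow hp hpq]
  have : SigmaFinite ((volume.withDensity fun x : ℝ =>
      ENNReal.ofReal (Real.exp (-|x| ^ p))).map (signedPow p)) := by
    rw [map_signedPow hp hpq]; exact SigmaFinite.withDensity_ofReal _
  rw [← Measure.pi_map_pi fun _ => hm.aemeasurable, lintegral_map (by fun_prop) (by fun_prop)]

/-- `powerAbs p` is Schur concave in the squares of the coefficients. -/
theorem powerAbs_le_of_majorizes {n : ℕ} {p : ℝ} (hp : 2 < p) {a b : Fin n → ℝ}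
    (hab : Majorizes (fun j => b j ^ 2) (fun j => a j ^ 2)) : powerAbs p b ≤ powerAbs p a := by
  have hp1 : 0 < p - 1 := by linarith
  -- Half the conjugate exponent; `p > 2` is exactly what gives `α < 1`.
  set α : ℝ := p / (p - 1) / 2 with hα
  have h1 : 1 / 2 < α := by rw [hα, div_lt_div_iff_of_pos_right two_pos, lt_div_iff₀ hp1]; linarith
  have h2 : α < 1 := by rw [hα, div_lt_one two_pos, div_lt_iff₀ hp1]; linarith
  have hpq : (p - 1) * (2 * α - 1) = 1 := by rw [hα]; field_simp; ring
  have e : ∀ a : Fin n → ℝ, powerAbs p a = ENNReal.ofReal ((p - 1)⁻¹ ^ n) *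
      weightedAbs (fun y => |y| ^ (2 * α - 2) * Real.exp (-(1 * |y| ^ (2 * α)))) a := fun a => by
    rw [powerAbs_eq_weightedAbs hp hpq, weightedAbs_const_mul (by positivity) _ (by fun_prop)]
  rw [e, e]
  gcongr
  exact (squareConcave_weightedAbs h1 h2).le_of_majorizes
    (weightedAbs_ne_top (by linarith) (by linarith) one_pos) (weightedAbs_perm _) hab

/-! ### Integrals along lines and of homogeneous functions. -/

lemma lintegral_Ioi_abs_deriv_mul_exp_neg {φ φ' : ℝ → ℝ} {s₀ : ℝ}
    (hφ : ∀ s, HasDerivAt φ (φ' s) s) (hpos : ∀ s, s₀ < s → 0 ≤ φ' s)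
    (htop : Filter.Tendsto φ Filter.atTop Filter.atTop) :
    ∫⁻ s in Set.Ioi s₀, ENNReal.ofReal (|φ' s| * Real.exp (-φ s)) =
      ENNReal.ofReal (Real.exp (-φ s₀)) := by
  have hd : ∀ s, HasDerivAt (fun s => -Real.exp (-φ s)) (φ' s * Real.exp (-φ s)) s := fun s =>
    ((hφ s).neg.exp.neg).congr_deriv (by rw [Pi.neg_apply]; ring)
  have hnn : ∀ s ∈ Set.Ioi s₀, 0 ≤ φ' s * Real.exp (-φ s) := fun s hs =>
    mul_nonneg (hpos s hs) (Real.exp_nonneg _)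
  have hlim : Filter.Tendsto (fun s => -Real.exp (-φ s)) Filter.atTop (nhds 0) := by
    simpa [Function.comp_def] using (Real.tendsto_exp_neg_atTop_nhds_zero.comp htop).neg
  have h1 := integral_Ioi_of_hasDerivAt_of_nonneg' (fun s _ => hd s) hnn hlim
  have h2 := integrableOn_Ioi_deriv_of_nonneg' (fun s _ => hd s) hnn hlim
  rw [zero_sub, neg_neg] at h1
  rw [← h1, ofReal_integral_eq_lintegral_ofReal h2
    ((ae_restrict_mem measurableSet_Ioi).mono fun s hs => hnn s hs)]
  exact setLIntegral_congr_fun measurableSet_Ioi fun s hs => by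
    simp only [abs_of_nonneg (hpos s hs)]

/-- The total variation of `e^{-φ}` for a convex coercive function `φ`. -/
lemma lintegral_abs_deriv_mul_exp_neg {φ φ' : ℝ → ℝ} (hφ : ∀ s, HasDerivAt φ (φ' s) s)
    (hmono : Monotone φ') (htop : Filter.Tendsto φ Filter.atTop Filter.atTop)
    (hbot : Filter.Tendsto φ Filter.atBot Filter.atTop) :
    ∃ s₀, (∀ s, φ s₀ ≤ φ s) ∧ ∫⁻ s, ENNReal.ofReal (|φ' s| * Real.exp (-φ s)) =
      2 * ENNReal.ofReal (Real.exp (-φ s₀)) := by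
  have hc : Continuous φ := continuous_iff_continuousAt.2 fun s => (hφ s).continuousAt
  obtain ⟨s₀, hs₀⟩ := hc.exists_forall_le (by
    rw [cocompact_eq_atBot_atTop]; exact hbot.sup htop)
  refine ⟨s₀, hs₀, ?_⟩
  have h0 : φ' s₀ = 0 :=
    IsLocalMin.hasDerivAt_eq_zero (Filter.Eventually.of_forall hs₀) (hφ s₀)
  have hr := lintegral_Ioi_abs_deriv_mul_exp_neg (s₀ := s₀) hφ
    (fun s hs => h0 ▸ hmono hs.le) htop
  -- The decreasing half, handled by reflecting `s ↦ -s`; each half contributes `e^{-φ(s₀)}`.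
  have hl := lintegral_Ioi_abs_deriv_mul_exp_neg (φ := fun s => φ (-s)) (φ' := fun s => -φ' (-s))
    (s₀ := -s₀) (fun s => ((hφ (-s)).comp s (hasDerivAt_neg s)).congr_deriv (by ring))
    (fun s hs => by have := hmono (by linarith : -s ≤ s₀); linarith)
    (hbot.comp Filter.tendsto_neg_atTop_atBot)
  have hneg := (Measure.measurePreserving_neg (volume : Measure ℝ)).setLIntegral_comp_preimage_emb
    (Homeomorph.neg ℝ).measurableEmbedding
    (fun s => ENNReal.ofReal (|φ' s| * Real.exp (-φ s))) (Set.Iio s₀)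
  rw [show Neg.neg ⁻¹' Set.Iio s₀ = Set.Ioi (-s₀) by ext; simp] at hneg
  simp only [abs_neg, neg_neg] at hl
  rw [← lintegral_add_compl _ (measurableSet_Ioi (a := s₀)), Set.compl_Ioi, hr,
    setLIntegral_congr Iio_ae_eq_Iic.symm, ← hneg, hl, two_mul]

/-- Integrating `e^{-m}` for a homogeneous function `m`. -/
lemma lintegral_exp_neg_of_homogeneous {W : Type*} [NormedAddCommGroup W] [NormedSpace ℝ W]
    [MeasurableSpace W] [BorelSpace W] [FiniteDimensional ℝ W] (μ : Measure W)
    [μ.IsAddHaarMeasure] {m : W → ℝ} (hm : Measurable m) (hm0 : ∀ y, 0 ≤ m y) {p : ℝ} (hp : 0 < p)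
    (hhom : ∀ (c : ℝ) y, 0 < c → m (c • y) = c ^ p * m y) :
    ∫⁻ y, ENNReal.ofReal (Real.exp (-m y)) ∂μ =
      (∫⁻ r in Set.Ioi (0 : ℝ),
        ENNReal.ofReal (Real.exp (-r) * (r ^ p⁻¹) ^ Module.finrank ℝ W)) * μ {y | m y ≤ 1} := by
  have hexp : ∀ t : ℝ, ENNReal.ofReal (Real.exp (-t)) =
      ∫⁻ r in Set.Ici t, ENNReal.ofReal (Real.exp (-r)) := fun t => by
    rw [← setLIntegral_congr Ioi_ae_eq_Ici, ← integral_exp_neg_Ioi t,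
      ofReal_integral_eq_lintegral_ofReal
      (integrableOn_exp_neg_Ioi t) (ae_of_all _ fun r => Real.exp_nonneg _)]
  -- By homogeneity `{m ≤ r}` is the dilate of `{m ≤ 1}` by `r^{1/p}`; the layer-cake formula below
  -- then separates the variables.
  have hball : ∀ r : ℝ, 0 < r → μ {y | m y ≤ r} =
      ENNReal.ofReal ((r ^ p⁻¹) ^ Module.finrank ℝ W) * μ {y | m y ≤ 1} := fun r hr => by
    have hc : 0 < r ^ p⁻¹ := by positivity
    have h := Measure.addHaar_preimage_smul μ (inv_ne_zero hc.ne') {y | m y ≤ 1}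
    rw [inv_pow, inv_inv, abs_of_pos (by positivity)] at h
    rw [← h]
    congr 1
    ext y
    simp only [Set.mem_preimage, Set.mem_ofPred_eq]
    rw [hhom _ _ (inv_pos.2 hc), Real.inv_rpow hc.le, ← Real.rpow_mul hr.le,
      inv_mul_cancel₀ hp.ne', Real.rpow_one, inv_mul_le_iff₀ hr, mul_one]
  calc ∫⁻ y, ENNReal.ofReal (Real.exp (-m y)) ∂μ
      = ∫⁻ y, (∫⁻ r in Set.Ici (0 : ℝ), {q : W × ℝ | m q.1 ≤ q.2}.indicator
          (fun q => ENNReal.ofReal (Real.exp (-q.2))) (y, r)) ∂μ := by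
        refine lintegral_congr fun y => ?_
        rw [hexp, ← lintegral_indicator measurableSet_Ici, ← lintegral_indicator measurableSet_Ici]
        refine lintegral_congr fun r => ?_
        have := hm0 y
        by_cases h1 : m y ≤ r
        · simp [h1, this.trans h1]
        · simp [Set.indicator, h1]
    _ = ∫⁻ r in Set.Ici (0 : ℝ), (∫⁻ y, {q : W × ℝ | m q.1 ≤ q.2}.indicator
          (fun q => ENNReal.ofReal (Real.exp (-q.2))) (y, r) ∂μ) := by
        refine lintegral_lintegral_swap (Measurable.aemeasurable ?_)
        exact Measurable.indicator (by fun_prop)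
          (measurableSet_le (hm.comp measurable_fst) measurable_snd)
    _ = ∫⁻ r in Set.Ioi (0 : ℝ),
          ENNReal.ofReal (Real.exp (-r) * (r ^ p⁻¹) ^ Module.finrank ℝ W) * μ {y | m y ≤ 1} := by
        rw [← setLIntegral_congr Ioi_ae_eq_Ici]
        refine setLIntegral_congr_fun measurableSet_Ioi fun r hr => ?_
        rw [ENNReal.ofReal_mul (Real.exp_nonneg _), mul_assoc, ← hball r hr,
          ← setLIntegral_const, ← lintegral_indicator (measurableSet_le hm measurable_const)]
        rfl
    _ = _ := lintegral_mul_const _ (by fun_prop)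

/-! ### Volume formula for projections. -/

/-- `∑ |x_j|^p`. -/
noncomputable def powerSum {n : ℕ} (p : ℝ) (x : EuclideanSpace ℝ (Fin n)) : ℝ := ∑ j, |x j| ^ p

lemma powerSum_nonneg {n : ℕ} (p : ℝ) (x : EuclideanSpace ℝ (Fin n)) : 0 ≤ powerSum p x :=
  Finset.sum_nonneg fun _ _ => by positivity

lemma continuous_powerSum {n : ℕ} {p : ℝ} (hp : 0 < p) :
    Continuous (powerSum p : EuclideanSpace ℝ (Fin n) → ℝ) :=
  continuous_finsetSum _ fun j _ =>
    (by fun_prop : Continuous fun x : EuclideanSpace ℝ (Fin n) => |x j|).rpow_const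
      fun _ => Or.inr hp.le

lemma powerSum_smul {n : ℕ} {p c : ℝ} (hc : 0 < c) (x : EuclideanSpace ℝ (Fin n)) :
    powerSum p (c • x) = c ^ p * powerSum p x := by
  rw [powerSum, powerSum, Finset.mul_sum]
  refine Finset.sum_congr rfl fun j _ => ?_
  rw [PiLp.smul_apply, smul_eq_mul, abs_mul, abs_of_pos hc,
    Real.mul_rpow hc.le (abs_nonneg _)]

lemma hasDerivAt_powerSum_line {n : ℕ} {p : ℝ} (hp : 2 < p) (a y : EuclideanSpace ℝ (Fin n))
    (s : ℝ) : HasDerivAt (fun s : ℝ => powerSum p (s • a + y))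
      (p * ∑ j, a j * signedPow p ((s • a + y) j)) s := by
  have key : ∀ j ∈ Finset.univ, HasDerivAt (fun s : ℝ => |(s • a + y) j| ^ p)
      (p * (a j * signedPow p ((s • a + y) j))) s := fun j _ => by
    have h1 : HasDerivAt (fun s : ℝ => (s • a + y) j) (a j) s := by
      simpa using ((hasDerivAt_id s).mul_const (a j)).add_const (y j)
    refine ((hasDerivAt_abs_rpow ((s • a + y) j) (by linarith : 1 < p)).comp s h1).congr_deriv ?_
    simp only [signedPow]
    ring
  rw [Finset.mul_sum]
  exact HasDerivAt.fun_sum key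

lemma monotone_deriv_powerSum_line {n : ℕ} {p : ℝ} (hp : 2 < p)
    (a y : EuclideanSpace ℝ (Fin n)) :
    Monotone fun s : ℝ => p * ∑ j, a j * signedPow p ((s • a + y) j) := by
  intro s t hst
  refine mul_le_mul_of_nonneg_left (Finset.sum_le_sum fun j _ => ?_) (by linarith)
  have hm := (strictMono_signedPow hp).monotone
  rcases le_total 0 (a j) with h | h
  · refine mul_le_mul_of_nonneg_left (hm ?_) h
    simpa using mul_le_mul_of_nonneg_right hst h
  · refine mul_le_mul_of_nonpos_left (hm ?_) h
    simpa using mul_le_mul_of_nonpos_right hst h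

lemma tendsto_powerSum_line {n : ℕ} {p : ℝ} (hp : 0 < p) {a : EuclideanSpace ℝ (Fin n)}
    (ha : a ≠ 0) (y : EuclideanSpace ℝ (Fin n)) :
    Filter.Tendsto (fun s : ℝ => powerSum p (s • a + y)) (Filter.cocompact ℝ) Filter.atTop := by
  obtain ⟨j, hj⟩ : ∃ j, a j ≠ 0 := by
    by_contra! h
    exact ha (PiLp.ext h)
  have h1 : Filter.Tendsto (fun s : ℝ => |s * a j + y j|) (Filter.cocompact ℝ) Filter.atTop := by
    have e : Topology.IsClosedEmbedding fun s : ℝ => s * a j + y j :=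
      ((Homeomorph.mulRight₀ (a j) hj).trans (Homeomorph.addRight (y j))).isClosedEmbedding
    exact (tendsto_norm_cocompact_atTop (E := ℝ)).comp e.tendsto_cocompact
  refine Filter.tendsto_atTop_mono (fun s => ?_) ((tendsto_rpow_atTop hp).comp h1)
  exact Finset.single_le_sum (f := fun i => |(s • a + y) i| ^ p) (fun i _ => by positivity)
    (Finset.mem_univ j)

/-- The minimum of `∑ |x_j|^p` over the line through `y` in direction `a`. -/
noncomputable def powerSumDist {n : ℕ} (p : ℝ) (a y : EuclideanSpace ℝ (Fin n)) : ℝ :=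
  ⨅ s : ℝ, powerSum p (s • a + y)

lemma bddBelow_powerSum_line {n : ℕ} (p : ℝ) (a y : EuclideanSpace ℝ (Fin n)) :
    BddBelow (Set.range fun s : ℝ => powerSum p (s • a + y)) :=
  ⟨0, by rintro _ ⟨s, rfl⟩; exact powerSum_nonneg _ _⟩

/-- The infimum is over uncountably many `s`, so measurability comes from semicontinuity: an infimum
of continuous functions is upper semicontinuous. -/
lemma measurable_powerSumDist {n : ℕ} {p : ℝ} (hp : 0 < p) (a : EuclideanSpace ℝ (Fin n)) :
    Measurable (powerSumDist p a) := by
  have h : UpperSemicontinuous fun y => ⨅ s : ℝ, powerSum p (s • a + y) :=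
    upperSemicontinuous_ciInf (fun y => bddBelow_powerSum_line p a y) fun s =>
      ((continuous_powerSum hp).comp (by fun_prop)).upperSemicontinuous
  exact h.measurable

lemma powerSumDist_smul {n : ℕ} {p c : ℝ} (hc : 0 < c) (a y : EuclideanSpace ℝ (Fin n)) :
    powerSumDist p a (c • y) = c ^ p * powerSumDist p a y := by
  rw [powerSumDist, powerSumDist, Real.mul_iInf_of_nonneg (by positivity),
    ← (Homeomorph.mulLeft₀ c hc.ne').surjective.iInf_comp]
  refine iInf_congr fun s => ?_
  rw [← powerSum_smul hc, smul_add, smul_smul]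
  rfl

lemma exists_powerSumDist_eq {n : ℕ} {p : ℝ} (hp : 2 < p) {a : EuclideanSpace ℝ (Fin n)}
    (ha : a ≠ 0) (y : EuclideanSpace ℝ (Fin n)) :
    (∃ s : ℝ, powerSumDist p a y = powerSum p (s • a + y)) ∧
    ∫⁻ s : ℝ, ENNReal.ofReal (|p * ∑ j, a j * signedPow p ((s • a + y) j)| *
      Real.exp (-powerSum p (s • a + y))) = 2 * ENNReal.ofReal (Real.exp (-powerSumDist p a y)) := by
  have ht := tendsto_powerSum_line (by linarith : 0 < p) ha y
  rw [cocompact_eq_atBot_atTop, Filter.tendsto_sup] at ht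
  obtain ⟨s₀, h1, h2⟩ := lintegral_abs_deriv_mul_exp_neg (hasDerivAt_powerSum_line hp a y)
    (monotone_deriv_powerSum_line hp a y) ht.2 ht.1
  have e : powerSumDist p a y = powerSum p (s₀ • a + y) :=
    le_antisymm (ciInf_le (bddBelow_powerSum_line p a y) s₀) (le_ciInf h1)
  exact ⟨⟨s₀, e⟩, by rw [h2, e]⟩

/-- Integration over `ℝⁿ` along the lines in direction of a unit vector. -/
lemma lintegral_eq_lintegral_orthogonal {E : Type*} [NormedAddCommGroup E] [InnerProductSpace ℝ E]
    [MeasurableSpace E] [BorelSpace E] [FiniteDimensional ℝ E] {a : E} (ha : ‖a‖ = 1)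
    {f : E → ℝ≥0∞} (hf : Measurable f) :
    ∫⁻ x, f x = ∫⁻ y : (ℝ ∙ a)ᗮ, ∫⁻ s : ℝ, f (s • a + y) := by
  have h := ((ℝ ∙ a).measurePreserving_measurableEquivProd (0 : E)).symm
  rw [InnerProductSpace.euclideanHausdorffMeasure_eq_volume] at h
  rw [← h.lintegral_comp hf, Measure.volume_eq_prod, lintegral_prod_symm
    (fun z => f (((ℝ ∙ a).measurableEquivProd (0 : E)).symm z)) (hf.comp (MeasurableEquiv.measurable _)).aemeasurable]
  refine lintegral_congr fun y => ?_
  rw [← (LinearIsometryEquiv.toSpanUnitSingleton (𝕜 := ℝ) a ha).measurePreserving.lintegral_comp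
    (by fun_prop)]
  simp

/-- A point of `a^⊥` lies in the projection iff its fibre, a line in direction `a`, meets the ball;
since the minimum on that line is attained, this says the minimum is at most 1. -/
lemma image_sublevel_powerSumDist {n : ℕ} {p : ℝ} (hp : 2 < p) {a : EuclideanSpace ℝ (Fin n)}
    (ha : ‖a‖ = 1) :
    Subtype.val '' {y : (ℝ ∙ a)ᗮ | powerSumDist p a y ≤ 1} =
      hyperplaneProjection a {x | powerSum p x ≤ 1} := by
  have ha0 : a ≠ 0 := by rintro rfl; simp at ha
  ext z
  constructor
  · rintro ⟨y, hy, rfl⟩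
    have hy : powerSumDist p a y ≤ 1 := hy
    obtain ⟨s, hs⟩ := (exists_powerSumDist_eq hp ha0 (y : EuclideanSpace ℝ (Fin n))).1
    refine ⟨s • a + y, (hs ▸ hy : powerSum p _ ≤ 1), ?_⟩
    rw [map_add, Submodule.starProjection_eq_self_iff.2 y.2,
      (Submodule.starProjection_apply_eq_zero_iff _).2, zero_add]
    rw [Submodule.orthogonal_orthogonal]
    exact Submodule.smul_mem _ _ (Submodule.mem_span_singleton_self a)
  · rintro ⟨x, hx, rfl⟩
    refine ⟨⟨_, Submodule.starProjection_apply_mem _ x⟩, ?_, rfl⟩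
    have hx : powerSum p x ≤ 1 := hx
    have e : x = inner ℝ a x • a + (ℝ ∙ a)ᗮ.starProjection x := by
      rw [← Submodule.starProjection_unit_singleton ℝ ha,
        Submodule.starProjection_add_starProjection_orthogonal]
    refine (ciInf_le (bddBelow_powerSum_line p a _) (inner ℝ a x)).trans ?_
    rwa [← e]

/-- The constant in the volume formula for projections of `ℓ_p` balls. -/
noncomputable def projectionConst (p : ℝ) (d : ℕ) : ℝ≥0∞ :=
  2 * ∫⁻ r in Set.Ioi (0 : ℝ), ENNReal.ofReal (Real.exp (-r) * (r ^ p⁻¹) ^ d)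

lemma projectionConst_ne_zero (p : ℝ) (d : ℕ) : projectionConst p d ≠ 0 := by
  refine mul_ne_zero two_ne_zero (ne_of_gt ?_)
  rw [setLIntegral_pos_iff (by fun_prop)]
  have : Set.Ioi (0 : ℝ) ⊆ Function.support (fun r : ℝ =>
      ENNReal.ofReal (Real.exp (-r) * (r ^ p⁻¹) ^ d)) ∩ Set.Ioi 0 := fun r hr => by
    have hr' : (0 : ℝ) < r := hr
    exact ⟨(ENNReal.ofReal_pos.2 (by positivity)).ne', hr⟩
  exact (by simp : (0 : ℝ≥0∞) < volume (Set.Ioi (0 : ℝ))).trans_le (measure_mono this)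

/-- The integral is `Γ(d/p + 1)`. Finite and nonzero, the constant can be cancelled from the volume
comparison. -/
lemma projectionConst_ne_top {p : ℝ} (hp : 0 < p) (d : ℕ) : projectionConst p d ≠ ∞ := by
  refine ENNReal.mul_ne_top (by simp) ?_
  have h := Real.GammaIntegral_convergent (s := p⁻¹ * d + 1) (by positivity)
  have h2 : IntegrableOn (fun r : ℝ => Real.exp (-r) * (r ^ p⁻¹) ^ d) (Set.Ioi 0) := by
    refine h.congr_fun (fun r hr => ?_) measurableSet_Ioi
    have hr : (0 : ℝ) < r := hr
    simp only [add_sub_cancel_right]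
    rw [Real.rpow_mul hr.le, Real.rpow_natCast]
  exact ((hasFiniteIntegral_iff_ofReal ((ae_restrict_mem measurableSet_Ioi).mono fun r hr => by
    have hr : (0 : ℝ) < r := hr
    positivity)).1 h2.2).ne

/-- The volume of the projection of the `ℓ_p` ball onto a hyperplane as an integral. -/
theorem ofReal_mul_powerAbs {n : ℕ} {p : ℝ} (hp : 2 < p) {a : EuclideanSpace ℝ (Fin n)}
    (ha : ‖a‖ = 1) : ENNReal.ofReal p * powerAbs p (fun j => a j) =
      projectionConst p (n - 1) * vol (n - 1) (hyperplaneProjection a {x | powerSum p x ≤ 1}) := by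
  have ha0 : a ≠ 0 := by rintro rfl; simp at ha
  have hp0 : 0 < p := by linarith
  have hσ := measurable_signedPow p
  have hN : Measurable (powerSum p : EuclideanSpace ℝ (Fin n) → ℝ) :=
    (continuous_powerSum hp0).measurable
  have hd : Module.finrank ℝ (ℝ ∙ a)ᗮ = n - 1 := by
    have h := Submodule.finrank_add_finrank_orthogonal (ℝ ∙ a)
    rw [finrank_span_singleton ha0, finrank_euclideanSpace_fin] at h
    omega
  calc ENNReal.ofReal p * powerAbs p (fun j => a j)
      = ∫⁻ x : EuclideanSpace ℝ (Fin n), ENNReal.ofReal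
          (|p * ∑ j, a j * signedPow p (x j)| * Real.exp (-powerSum p x)) := by
        rw [powerAbs, ← lintegral_const_mul _ (by fun_prop),
          ← (PiLp.volume_preserving_toLp (Fin n)).lintegral_comp (by fun_prop)]
        refine lintegral_congr fun x => ?_
        rw [← ENNReal.ofReal_mul hp0.le, abs_mul, abs_of_pos hp0, powerSum,
          ← Finset.sum_neg_distrib, Real.exp_sum, mul_assoc]
    _ = ∫⁻ y : (ℝ ∙ a)ᗮ, 2 * ENNReal.ofReal (Real.exp (-powerSumDist p a y)) := by
        rw [lintegral_eq_lintegral_orthogonal ha (by fun_prop)]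
        exact lintegral_congr fun y => (exists_powerSumDist_eq hp ha0 _).2
    _ = _ := by
        have hm : Measurable fun y : (ℝ ∙ a)ᗮ => powerSumDist p a y :=
          (measurable_powerSumDist hp0 a).comp measurable_subtype_coe
        rw [lintegral_const_mul _ (by fun_prop), lintegral_exp_neg_of_homogeneous volume hm
          (fun y => Real.iInf_nonneg fun s => powerSum_nonneg _ _) hp0
          (fun c y hc => powerSumDist_smul hc a y), hd, ← mul_assoc, projectionConst, vol,
          ← image_sublevel_powerSumDist hp ha,
          isometry_subtype_coe.euclideanHausdorffMeasure_image, ← hd,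
          InnerProductSpace.euclideanHausdorffMeasure_eq_volume]

/-! ### Finite exponents, and the limit `p → ∞`. -/

lemma lpBall_eq_powerSum {n : ℕ} {p : ℝ≥0∞} (hp : 0 < p.toReal) :
    lpBall p n = {x | powerSum p.toReal x ≤ 1} := by
  ext x
  have h0 := powerSum_nonneg p.toReal x
  simp only [lpBall, Set.mem_ofPred_eq]
  rw [PiLp.norm_eq_sum hp]
  simp only [Real.norm_eq_abs]
  change powerSum p.toReal x ^ (1 / p.toReal) ≤ 1 ↔ _
  have h := Real.rpow_le_rpow_iff h0 zero_le_one (one_div_pos.2 hp)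
  rwa [Real.one_rpow] at h

theorem vol_hyperplaneProjection_le_of_ne_top {n : ℕ} {p : ℝ≥0∞} (hp : 2 < p) (hp' : p ≠ ∞)
    {a b : EuclideanSpace ℝ (Fin n)} (ha : ‖a‖ = 1) (hb : ‖b‖ = 1)
    (hmaj : Majorizes (fun j => b j ^ 2) (fun j => a j ^ 2)) :
    vol (n - 1) (hyperplaneProjection b (lpBall p n)) ≤
      vol (n - 1) (hyperplaneProjection a (lpBall p n)) := by
  have hp2 : 2 < p.toReal := by
    simpa using (ENNReal.toReal_lt_toReal (by simp) hp').2 hp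
  have hp0 : 0 < p.toReal := by linarith
  have h := mul_le_mul_right (powerAbs_le_of_majorizes hp2 hmaj) (ENNReal.ofReal p.toReal)
  rw [ofReal_mul_powerAbs hp2 ha, ofReal_mul_powerAbs hp2 hb, ← lpBall_eq_powerSum hp0] at h
  exact (ENNReal.mul_le_mul_iff_right (projectionConst_ne_zero _ _)
    (projectionConst_ne_top hp0 _)).1 h

open scoped Pointwise in
lemma vol_hyperplaneProjection_smul {n : ℕ} (k : ℕ) (a : EuclideanSpace ℝ (Fin n)) {c : ℝ}
    (hc : 0 < c) (K : Set (EuclideanSpace ℝ (Fin n))) :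
    vol k (hyperplaneProjection a (c • K)) = ENNReal.ofReal (c ^ k) *
      vol k (hyperplaneProjection a K) := by
  have e : hyperplaneProjection a (c • K) = c • hyperplaneProjection a K :=
    Set.image_smul_comm _ _ _ fun x => map_smul _ c x
  rw [e, vol, Measure.euclideanHausdorffMeasure_smul₀ k hc.ne', ENNReal.smul_def, smul_eq_mul, vol]
  congr 1
  rw [ENNReal.coe_pow, ENNReal.ofReal_pow hc.le]
  congr 1
  exact Real.enorm_eq_ofReal hc.le

lemma mem_lpBall_top {n : ℕ} {x : EuclideanSpace ℝ (Fin n)} :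
    x ∈ lpBall ∞ n ↔ ∀ j, |x j| ≤ 1 := by
  simp only [lpBall, Set.mem_ofPred_eq]
  rw [PiLp.norm_toLp, pi_norm_le_iff_of_nonneg zero_le_one]
  rfl

lemma lpBall_subset_lpBall_top {n : ℕ} {p : ℝ≥0∞} (hp : 0 < p.toReal) :
    lpBall p n ⊆ lpBall ∞ n := by
  intro x hx
  rw [lpBall_eq_powerSum hp] at hx
  refine mem_lpBall_top.2 fun j => ?_
  have h1 : |x j| ^ p.toReal ≤ 1 := (Finset.single_le_sum (f := fun i => |x i| ^ p.toReal)
    (fun i _ => by positivity) (Finset.mem_univ j)).trans hx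
  by_contra! h
  exact absurd h1 (not_le.2 (Real.one_lt_rpow h hp))

open scoped Pointwise in
lemma smul_lpBall_top_subset {n : ℕ} (hn : n ≠ 0) {p : ℝ≥0∞} (hp : 0 < p.toReal) :
    (n : ℝ) ^ (-p.toReal⁻¹) • lpBall ∞ n ⊆ lpBall p n := by
  rintro _ ⟨x, hx, rfl⟩
  have hn' : (0 : ℝ) < n := by positivity
  rw [lpBall_eq_powerSum hp]
  change powerSum _ (_ • x) ≤ 1
  rw [powerSum_smul (by positivity), ← Real.rpow_mul hn'.le, neg_mul, inv_mul_cancel₀ hp.ne',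
    Real.rpow_neg_one, inv_mul_le_iff₀ hn', mul_one]
  calc powerSum p.toReal x ≤ ∑ _j : Fin n, (1 : ℝ) := Finset.sum_le_sum fun j _ =>
        Real.rpow_le_one (abs_nonneg _) (mem_lpBall_top.1 hx j) hp.le
    _ = n := by simp

theorem theorem3p8 (n : ℕ) (p : ℝ≥0∞) (hp : 2 < p) (a b : EuclideanSpace ℝ (Fin n))
    (ha : ‖a‖ = 1) (hb : ‖b‖ = 1)
    (hmaj : Majorizes (fun j => b j ^ 2) (fun j => a j ^ 2)) :
    vol (n - 1) (hyperplaneProjection a (lpBall p n)) ≥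
      vol (n - 1) (hyperplaneProjection b (lpBall p n)) := by
  by_cases hp' : p = ∞
  swap
  · exact vol_hyperplaneProjection_le_of_ne_top hp hp' ha hb hmaj
  subst hp'
  have hn : n ≠ 0 := by
    rintro rfl
    simp [Subsingleton.elim a 0] at ha
  have hn' : (0 : ℝ) < n := by positivity
  -- Use exponents `k + 3 > 2` and `n^{-1/(k+3)} B_∞ ⊆ B_{k+3} ⊆ B_∞`. The dilation costs a factor
  -- that tends to 1.
  have hle : ∀ k : ℕ, ENNReal.ofReal (((n : ℝ) ^ (-((k : ℝ) + 3)⁻¹)) ^ (n - 1)) *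
      vol (n - 1) (hyperplaneProjection b (lpBall ∞ n)) ≤
        vol (n - 1) (hyperplaneProjection a (lpBall ∞ n)) := fun k => by
    have hk : (((k + 3 : ℕ) : ℝ≥0∞)).toReal = (k : ℝ) + 3 := by
      rw [ENNReal.toReal_natCast]; push_cast; rfl
    have hk0 : 0 < (((k + 3 : ℕ) : ℝ≥0∞)).toReal := by rw [hk]; positivity
    rw [← hk, ← vol_hyperplaneProjection_smul _ _ (by positivity)]
    calc _ ≤ vol (n - 1) (hyperplaneProjection b (lpBall (k + 3 : ℕ) n)) :=
          measure_mono (Set.image_mono (smul_lpBall_top_subset hn hk0))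
      _ ≤ vol (n - 1) (hyperplaneProjection a (lpBall (k + 3 : ℕ) n)) :=
          vol_hyperplaneProjection_le_of_ne_top (by exact_mod_cast (by omega : 2 < k + 3))
            (ENNReal.natCast_ne_top _) ha hb hmaj
      _ ≤ _ := measure_mono (Set.image_mono (lpBall_subset_lpBall_top hk0))
  have hlim : Filter.Tendsto (fun k : ℕ => ((n : ℝ) ^ (-((k : ℝ) + 3)⁻¹)) ^ (n - 1)) Filter.atTop
      (nhds 1) := by
    have h1 : Filter.Tendsto (fun k : ℕ => -((k : ℝ) + 3)⁻¹) Filter.atTop (nhds 0) := by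
      simpa using (tendsto_inv_atTop_zero.comp
        (Filter.tendsto_atTop_add_const_right _ (3 : ℝ) tendsto_natCast_atTop_atTop)).neg
    have h2 := ((Real.continuousAt_const_rpow (b := 0) hn'.ne').tendsto.comp h1).pow (n - 1)
    simpa [Function.comp_def] using h2
  have h3 := ENNReal.Tendsto.mul_const (b := vol (n - 1) (hyperplaneProjection b (lpBall ∞ n)))
    ((ENNReal.continuous_ofReal.tendsto _).comp hlim) (Or.inl (by simp))
  rw [ENNReal.ofReal_one, one_mul] at h3
  exact le_of_tendsto' h3 hle
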